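/- Let $(\Omega,\mathcal A,\mu)$ be a $\sigma$-finite measure space, and let $L^p=L^p(\Omega,\mu)$ denote the spaces of (classes of) complex-valued functions. Let $T:L^1\to L^1$ be a Dunford–Schwartz operator, i.e. a linear operator with $\|Tf\|_1\le\|f\|_1$ for all $f\in L^1$ and $\|Tf\|_\infty\le\|f\|_\infty$ for all $f\in L^1\cap L^\infty$. Denote again by $T$ its unique extension to a linear operator on $L^1+L^\infty$ which satisfies $\|Tf\|_\infty\le\|f\|_\infty$ for all $f\in L^\infty$ and whose restriction to $L^\infty$ is $\sigma(L^\infty,L^1)$-continuous. Let $\{\beta_k\}_{k\ge0}\subset\mathbb C$ be a bounded Besicovitch sequence, i.e. $\sup_k|\beta_k|<\infty$ and for every $\varepsilon>0$ there is a trigonometric polynomial $P(k)=\sum_{j=1}^s z_j\lambda_j^k$ ($z_j\in\mathbb C$, $|\lambda_j|=1$) with $\limsup_{n\to\infty}\frac1n\sum_{k=0}^{n-1}|\beta_k-P(k)|<\varepsilon$. Put $\mathcal R_\mu=\{f\in L^1+L^\infty:\ \mu\{|f|>\lambda\}<\infty\text{ for all }\lambda>0\}$. Then for every $f\in\mathcal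 R_\mu$ there is $\widehat f\in\mathcal R_\mu$ such that the averages $$B_n(f)=\frac1n\sum_{k=0}^{n-1}\beta_kT^kf$$ converge to $\widehat f$ almost uniformly: for every $\varepsilon>0$ there is a measurable set $G\subset\Omega$ with $\mu(\Omega\setminus G)\le\varepsilon$ and $\|(\widehat f-B_n(f))\chi_G\|_\infty\to0$ as $n\to\infty$. -/

import Mathlib

open MeasureTheory Filter Topology
open scoped ENNReal ComplexConjugate

namespace DunfordSchwartz

/-- The space `L¹ + L^∞` of (classes of) complex functions. -/
noncomputable def L1AddLinf {Ω : Type*} [MeasurableSpace Ω] (μ : Measure Ω) : Submodule ℂ (Ω →ₘ[μ] ℂ) :=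
  Lp.LpSubmodule ℂ ℂ 1 μ ⊔ Lp.LpSubmodule ℂ ℂ ∞ μ

/-- The inclusion `L¹ ⊆ L¹ + L^∞`. -/
noncomputable def inclOne {Ω : Type*} [MeasurableSpace Ω] (μ : Measure Ω) : Lp ℂ 1 μ →ₗ[ℂ] L1AddLinf μ where
  toFun f := ⟨f, le_sup_left (a := Lp.LpSubmodule ℂ ℂ 1 μ) f.2⟩
  map_add' _ _ := rfl
  map_smul' _ _ := rfl

/-- The inclusion `L^∞ ⊆ L¹ + L^∞`. -/
noncomputable def inclTop {Ω : Type*} [MeasurableSpace Ω] (μ : Measure Ω) : Lp ℂ ∞ μ →ₗ[ℂ] L1AddLinf μ where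
  toFun h := ⟨h, le_sup_right (b := Lp.LpSubmodule ℂ ℂ ∞ μ) h.2⟩
  map_add' _ _ := rfl
  map_smul' _ _ := rfl

/-- A Dunford–Schwartz operator: a linear operator on `L¹` that is a contraction for `‖·‖₁` and,
on `L¹ ∩ L^∞`, for `‖·‖_∞`. -/
structure IsDunfordSchwartz {Ω : Type*} [MeasurableSpace Ω] {μ : Measure Ω}
    (T : Lp ℂ 1 μ →ₗ[ℂ] Lp ℂ 1 μ) : Prop where
  norm_le : ∀ f, ‖T f‖ ≤ ‖f‖
  eLpNorm_top_le : ∀ f : Lp ℂ 1 μ, MemLp f ∞ μ → eLpNorm (T f) ∞ μ ≤ eLpNorm f ∞ μ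

/-- The weak-star topology `σ(L^∞, L¹)` on `L^∞`. -/
@[reducible] noncomputable def weakStar {Ω : Type*} [MeasurableSpace Ω] (μ : Measure Ω) : TopologicalSpace (Lp ℂ ∞ μ) :=
  TopologicalSpace.induced (fun h (g : Lp ℂ 1 μ) => ∫ x, h x * g x ∂μ) Pi.topologicalSpace

/-- `S` is a linear operator on `L¹ + L^∞` which extends `T`, is a contraction of `L^∞`, and whose
restriction to `L^∞` is `σ(L^∞, L¹)`-continuous. -/
structure IsExtension {Ω : Type*} [MeasurableSpace Ω] {μ : Measure Ω}
    (T : Lp ℂ 1 μ →ₗ[ℂ] Lp ℂ 1 μ) (S : L1AddLinf μ →ₗ[ℂ] L1AddLinf μ) : Prop where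
  map_inclOne : ∀ f, S (inclOne μ f) = inclOne μ (T f)
  exists_restrict : ∃ R : Lp ℂ ∞ μ → Lp ℂ ∞ μ, (∀ h, S (inclTop μ h) = inclTop μ (R h)) ∧
    (∀ h, ‖R h‖ ≤ ‖h‖) ∧ Continuous[weakStar μ, weakStar μ] R

/-! ### Existence and uniqueness of the extension -/

theorem memLp_sgn {Ω : Type*} [MeasurableSpace Ω] {μ : Measure Ω} (v : Ω →ₘ[μ] ℂ) (s : Set Ω)
    (hs : MeasurableSet s) (hμs : μ s < ∞) (p : ℝ≥0∞) :
    MemLp (s.indicator fun x => conj (v x) / (‖v x‖ : ℂ)) p μ := by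
  have hm : AEStronglyMeasurable (fun x => conj (v x) / (‖v x‖ : ℂ)) μ := by
    have := v.measurable
    exact (by fun_prop : Measurable (fun x => conj (v x) / (‖v x‖ : ℂ))).aestronglyMeasurable
  have hb : ∀ x, ‖(s.indicator fun x => conj (v x) / (‖v x‖ : ℂ)) x‖ ≤ ‖s.indicator (fun _ => (1 : ℝ)) x‖ := by
    intro x
    by_cases hx : x ∈ s
    · simp only [Set.indicator_of_mem hx, norm_div, RCLike.norm_conj, Complex.norm_real, norm_norm, norm_one]
      exact div_self_le_one _
    · simp [Set.indicator_of_notMem hx]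
  exact (memLp_indicator_const p hs (1 : ℝ) (Or.inr hμs.ne)).mono (hm.indicator hs) (.of_forall hb)

theorem integrable_mul_Lp {Ω : Type*} [MeasurableSpace Ω] {μ : Measure Ω} (h : Lp ℂ ∞ μ)
    (g : Lp ℂ 1 μ) : Integrable (fun x => h x * g x) μ :=
  memLp_one_iff_integrable.1 ((Lp.memLp g).mul (Lp.memLp h))

theorem ae_norm_le_norm {Ω : Type*} [MeasurableSpace Ω] {μ : Measure Ω} (h : Lp ℂ ∞ μ) :
    ∀ᵐ x ∂μ, ‖h x‖ ≤ ‖h‖ := by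
  filter_upwards [ae_le_eLpNormEssSup (f := h) (μ := μ)] with x hx
  rw [← eLpNorm_exponent_top, ← ofReal_norm] at hx
  rw [Lp.norm_def]
  exact (ENNReal.ofReal_le_iff_le_toReal (Lp.eLpNorm_ne_top h)).1 hx

theorem norm_le_of_ae_norm_le {Ω : Type*} [MeasurableSpace Ω] {μ : Measure Ω} {h : Lp ℂ ∞ μ}
    {C : ℝ} (hC : 0 ≤ C) (H : ∀ᵐ x ∂μ, ‖h x‖ ≤ C) : ‖h‖ ≤ C := by
  rw [Lp.norm_def, eLpNorm_exponent_top]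
  exact ENNReal.toReal_le_of_le_ofReal hC (eLpNormEssSup_le_of_ae_bound H)

theorem norm_integral_mul_le {Ω : Type*} [MeasurableSpace Ω] {μ : Measure Ω} (h : Lp ℂ ∞ μ)
    (g : Lp ℂ 1 μ) : ‖∫ x, h x * g x ∂μ‖ ≤ ‖h‖ * ‖g‖ := by
  have h1 : ∫ x, ‖h x * g x‖ ∂μ ≤ ∫ x, ‖h‖ * ‖g x‖ ∂μ := by
    refine integral_mono_ae (integrable_mul_Lp h g).norm ((L1.integrable_coeFn g).norm.const_mul _) ?_
    filter_upwards [ae_norm_le_norm h] with x hx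
    rw [norm_mul]; gcongr
  rw [integral_const_mul, ← L1.norm_eq_integral_norm] at h1
  exact (norm_integral_le_integral_norm _).trans h1

theorem integral_mul_add {Ω : Type*} [MeasurableSpace Ω] {μ : Measure Ω} (h h' : Lp ℂ ∞ μ)
    (g : Lp ℂ 1 μ) : ∫ x, (h + h' : Lp ℂ ∞ μ) x * g x ∂μ = ∫ x, h x * g x ∂μ + ∫ x, h' x * g x ∂μ := by
  rw [← integral_add (integrable_mul_Lp h g) (integrable_mul_Lp h' g)]
  refine integral_congr_ae ?_
  filter_upwards [Lp.coeFn_add h h'] with x hx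
  rw [hx, Pi.add_apply, add_mul]

theorem integral_mul_smul {Ω : Type*} [MeasurableSpace Ω] {μ : Measure Ω} (c : ℂ) (h : Lp ℂ ∞ μ)
    (g : Lp ℂ 1 μ) : ∫ x, (c • h : Lp ℂ ∞ μ) x * g x ∂μ = c * ∫ x, h x * g x ∂μ := by
  rw [← integral_const_mul]
  refine integral_congr_ae ?_
  filter_upwards [Lp.coeFn_smul c h] with x hx
  rw [hx, Pi.smul_apply, smul_eq_mul, mul_assoc]

/-- `L^∞` is separated by `L¹ ∩ L^∞`. -/
theorem Linf_eq_of_pairing {Ω : Type*} [MeasurableSpace Ω] {μ : Measure Ω} [SigmaFinite μ]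
    {h h' : Lp ℂ ∞ μ}
    (H : ∀ g : Lp ℂ 1 μ, MemLp g ∞ μ → ∫ x, h x * g x ∂μ = ∫ x, h' x * g x ∂μ) : h = h' := by
  rw [← sub_eq_zero]
  set k := h - h' with hk
  have hz : ∀ s, MeasurableSet s → μ s < ∞ → ∫ x in s, (k x : ℂ) ∂μ = 0 := by
    intro s hs hμs
    have h1 : MemLp (s.indicator fun _ => (1 : ℂ)) 1 μ := memLp_indicator_const 1 hs 1 (Or.inr hμs.ne)
    have h2 : MemLp (s.indicator fun _ => (1 : ℂ)) ∞ μ := memLp_indicator_const ∞ hs 1 (Or.inr hμs.ne)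
    have e := H h1.toLp (h2.ae_eq h1.coeFn_toLp.symm)
    have e1 := integral_mul_add k h' h1.toLp
    rw [hk, sub_add_cancel, ← e, ← hk, right_eq_add] at e1
    rw [← e1, ← integral_indicator hs]
    refine integral_congr_ae ?_
    filter_upwards [h1.coeFn_toLp] with x hx
    rw [hx]; by_cases hxs : x ∈ s <;> simp [hxs]
  refine Lp.eq_zero_iff_ae_eq_zero.2 (ae_eq_zero_of_forall_setIntegral_eq_of_sigmaFinite ?_ hz)
  intro s hs hμs
  have : Fact (μ s < ∞) := ⟨hμs⟩
  exact ((Lp.memLp k).restrict s).integrable le_top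

/-- Riesz representation of the functionals on `L¹` of a `σ`-finite measure. -/
theorem exists_Linf_of_functional {Ω : Type*} [MeasurableSpace Ω] {μ : Measure Ω} [SigmaFinite μ]
    (φ : Lp ℂ 1 μ →L[ℂ] ℂ) {C : ℝ} (hC : ∀ g, ‖φ g‖ ≤ C * ‖g‖) (hC0 : 0 ≤ C) :
    ∃ h : Lp ℂ ∞ μ, ‖h‖ ≤ C ∧ ∀ g : Lp ℂ 1 μ, φ g = ∫ x, h x * g x ∂μ := by
  obtain ⟨a, ha0, ham, hafin⟩ := exists_pos_lintegral_lt_of_sigmaFinite μ one_ne_zero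
  set w : Ω → ℂ := fun x => (Real.sqrt (a x) : ℂ) with hw
  have hw0 : ∀ x, w x ≠ 0 := fun x => by
    simp only [hw, ne_eq, Complex.ofReal_eq_zero]
    exact (Real.sqrt_pos.2 (by exact_mod_cast ha0 x)).ne'
  have hwm : Measurable w := by fun_prop
  have haint : Integrable (fun x => (a x : ℝ)) μ := by
    refine ⟨by fun_prop, ?_⟩
    simp only [HasFiniteIntegral, NNReal.enorm_eq]
    exact hafin.trans ENNReal.one_lt_top
  have hwnorm : ∀ x, ‖w x‖ = Real.sqrt (a x) := fun x => by
    simp [hw]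
  have hw2 : MemLp w 2 μ := by
    rw [memLp_two_iff_integrable_sq_norm hwm.aestronglyMeasurable]
    simpa [hwnorm, Real.sq_sqrt] using haint
  let W : Lp ℂ 2 μ →L[ℂ] Lp ℂ 1 μ :=
    (ContinuousLinearMap.mul ℂ ℂ).holderL μ 2 2 1 hw2.toLp
  have hW : ∀ u : Lp ℂ 2 μ, W u =ᵐ[μ] fun x => w x * u x := fun u => by
    have := (ContinuousLinearMap.mul ℂ ℂ).coeFn_holder (r := 1) hw2.toLp u
    refine this.trans ?_
    filter_upwards [hw2.coeFn_toLp] with x hx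
    simp [hx]
  let v : Lp ℂ 2 μ := (InnerProductSpace.toDual ℂ (Lp ℂ 2 μ)).symm (φ ∘L W)
  have hv : ∀ u : Lp ℂ 2 μ, φ (W u) = ∫ x, conj (v x) * u x ∂μ := fun u => by
    have : inner ℂ v u = φ (W u) := by
      simp only [v, InnerProductSpace.toDual_symm_apply]; rfl
    rw [← this, L2.inner_def]
    refine integral_congr_ae (.of_forall fun x => ?_)
    simp [mul_comm]
  have hvm : Measurable v := (Lp.stronglyMeasurable v).measurable
  have hbound : ∀ᵐ x ∂μ, ‖v x‖ ≤ C * ‖w x‖ := by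
    have key : (fun x => ENNReal.ofReal ‖v x‖) ≤ᵐ[μ] fun x => ENNReal.ofReal (C * ‖w x‖) := by
      refine ae_le_of_forall_setLIntegral_le_of_sigmaFinite (by fun_prop) ?_
      intro s hs hμs
      have : Fact (μ s < ∞) := ⟨hμs⟩
      have iv : Integrable (fun x => ‖v x‖) (μ.restrict s) :=
        (((Lp.memLp v).restrict s).integrable one_le_two).norm
      have iw : Integrable (fun x => C * ‖w x‖) (μ.restrict s) :=
        (((hw2.restrict s).integrable one_le_two).norm).const_mul C
      rw [← ofReal_integral_eq_lintegral_ofReal iv (.of_forall fun _ => norm_nonneg _),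
        ← ofReal_integral_eq_lintegral_ofReal iw (.of_forall fun _ => by positivity)]
      refine ENNReal.ofReal_le_ofReal ?_
      have hu := (memLp_sgn (star v : Ω →ₘ[μ] ℂ) s hs hμs 2)
      have hu' : MemLp (s.indicator fun x => v x / (‖v x‖ : ℂ)) 2 μ := by
        refine hu.ae_eq ?_
        filter_upwards [AEEqFun.coeFn_star (v : Ω →ₘ[μ] ℂ)] with x hx
        by_cases hxs : x ∈ s <;> simp [hxs, hx]
      have e1 : φ (W hu'.toLp) = ((∫ x in s, ‖v x‖ ∂μ : ℝ) : ℂ) := by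
        rw [hv, ← integral_complex_ofReal, ← integral_indicator hs]
        refine integral_congr_ae ?_
        filter_upwards [hu'.coeFn_toLp] with x hx
        rw [hx]
        by_cases hxs : x ∈ s
        · simp only [Set.indicator_of_mem hxs]
          by_cases h0 : v x = 0
          · simp [h0]
          · have : (‖v x‖ : ℂ) ≠ 0 := by simpa using h0
            rw [← mul_div_assoc, Complex.conj_mul', sq, mul_div_assoc, div_self this, mul_one]
        · simp [hxs]
      have e2 : ‖W hu'.toLp‖ ≤ ∫ x in s, ‖w x‖ ∂μ := by
        rw [L1.norm_eq_integral_norm, ← integral_indicator hs]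
        refine integral_mono_ae (L1.integrable_coeFn _).norm
          ((integrable_indicator_iff hs).2 ((hw2.restrict s).integrable one_le_two).norm) ?_
        filter_upwards [hW hu'.toLp, hu'.coeFn_toLp] with x hx hx'
        rw [hx, hx']
        by_cases hxs : x ∈ s
        · simp only [Set.indicator_of_mem hxs, norm_mul, norm_div, Complex.norm_real, norm_norm]
          exact mul_le_of_le_one_right (norm_nonneg _) (div_self_le_one _)
        · simp [hxs]
      have e3 := hC (W hu'.toLp)
      rw [e1, Complex.norm_real, Real.norm_eq_abs] at e3
      rw [integral_const_mul]
      exact (le_abs_self _).trans (e3.trans (by gcongr))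
    filter_upwards [key] with x hx
    exact (ENNReal.ofReal_le_ofReal_iff (by positivity)).1 hx
  have hhb : ∀ᵐ x ∂μ, ‖conj (v x) / w x‖ ≤ C := by
    filter_upwards [hbound] with x hx
    rw [norm_div, RCLike.norm_conj, div_le_iff₀ (norm_pos_iff.2 (hw0 x))]
    exact hx
  have hh : MemLp (fun x => conj (v x) / w x) ∞ μ :=
    memLp_top_of_bound
      (by have := (Complex.continuous_conj.measurable.comp hvm).div hwm; exact this.aestronglyMeasurable)
      C hhb
  refine ⟨hh.toLp, ?_, fun g => ?_⟩
  · refine norm_le_of_ae_norm_le hC0 ?_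
    filter_upwards [hh.coeFn_toLp, hhb] with x hx hx'
    rwa [hx]
  · have hgm : Measurable g := (Lp.stronglyMeasurable g).measurable
    let s : ℕ → Set Ω := fun n => {x | ‖g x‖ ≤ n * a x}
    have hsm : ∀ n, MeasurableSet (s n) := fun n =>
      measurableSet_le (by fun_prop) (by fun_prop)
    have hgs : ∀ n, MemLp ((s n).indicator g) 1 μ := fun n => (Lp.memLp g).indicator (hsm n)
    have hus : ∀ n, MemLp ((s n).indicator fun x => g x / w x) 2 μ := fun n => by
      refine (hw2.const_mul (n : ℂ)).mono
        (((hgm.div hwm).indicator (hsm n)).aestronglyMeasurable) (.of_forall fun x => ?_)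
      by_cases hx : x ∈ s n
      · have hx' : ‖g x‖ ≤ n * a x := hx
        simp only [Set.indicator_of_mem hx, norm_div, norm_mul, Complex.norm_natCast]
        rw [div_le_iff₀ (norm_pos_iff.2 (hw0 x)), mul_assoc, hwnorm,
          Real.mul_self_sqrt (NNReal.coe_nonneg _)]
        exact hx'
      · rw [Set.indicator_of_notMem hx, norm_zero]; positivity
    have hWu : ∀ n, W (hus n).toLp = (hgs n).toLp := fun n => by
      refine Lp.ext ?_
      filter_upwards [hW (hus n).toLp, (hus n).coeFn_toLp, (hgs n).coeFn_toLp] with x h1 h2 h3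
      rw [h1, h2, h3]
      by_cases hx : x ∈ s n
      · simp only [Set.indicator_of_mem hx]; field_simp [hw0 x]
      · simp [hx]
    have heq : ∀ n, φ (hgs n).toLp = ∫ x, (hh.toLp _ : Lp ℂ ∞ μ) x * (s n).indicator g x ∂μ := fun n => by
      rw [← hWu, hv]
      refine integral_congr_ae ?_
      filter_upwards [(hus n).coeFn_toLp, hh.coeFn_toLp] with x h1 h2
      rw [h1, h2]
      by_cases hx : x ∈ s n
      · simp only [Set.indicator_of_mem hx]; ring
      · simp [hx]
    have hev : ∀ x, ∀ᶠ n in atTop, (s n).indicator g x = g x := fun x => by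
      obtain ⟨N, hN⟩ := exists_nat_ge (‖g x‖ / a x)
      filter_upwards [eventually_ge_atTop N] with n hn
      have ha : (0 : ℝ) < a x := by exact_mod_cast ha0 x
      rw [div_le_iff₀ ha] at hN
      have hx : x ∈ s n := hN.trans (by gcongr)
      exact Set.indicator_of_mem hx _
    have hlim1 : Tendsto (fun n => (hgs n).toLp) atTop (𝓝 g) := by
      rw [tendsto_iff_norm_sub_tendsto_zero]
      have : ∀ n, ‖(hgs n).toLp - g‖ = ∫ x, ‖(s n).indicator g x - g x‖ ∂μ := fun n => by
        rw [L1.norm_eq_integral_norm]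
        refine integral_congr_ae ?_
        filter_upwards [Lp.coeFn_sub (hgs n).toLp g, (hgs n).coeFn_toLp] with x h1 h2
        rw [h1, Pi.sub_apply, h2]
      simp_rw [this]
      rw [show (0 : ℝ) = ∫ x, (0 : ℝ) ∂μ by simp]
      refine tendsto_integral_of_dominated_convergence (fun x => ‖g x‖)
        (fun n => (((hgs n).1.sub (Lp.memLp g).1).norm)) (L1.integrable_coeFn g).norm
        (fun n => .of_forall fun x => ?_) (.of_forall fun x => ?_)
      · by_cases hx : x ∈ s n <;> simp [hx]
      · refine tendsto_const_nhds.congr' ?_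
        filter_upwards [hev x] with n hn
        simp [hn]
    have hlim2 : Tendsto (fun n => ∫ x, (hh.toLp _ : Lp ℂ ∞ μ) x * (s n).indicator g x ∂μ) atTop
        (𝓝 (∫ x, (hh.toLp _ : Lp ℂ ∞ μ) x * g x ∂μ)) := by
      refine tendsto_integral_of_dominated_convergence (fun x => ‖(hh.toLp _ : Lp ℂ ∞ μ) x * g x‖)
        (fun n => (Lp.memLp (hh.toLp _)).1.mul (hgs n).1) (integrable_mul_Lp (hh.toLp _) g).norm
        (fun n => .of_forall fun x => ?_) (.of_forall fun x => ?_)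
      · by_cases hx : x ∈ s n <;> simp [hx]; positivity
      · refine tendsto_const_nhds.congr' ?_
        filter_upwards [hev x] with n hn
        simp [hn]
    refine tendsto_nhds_unique ((φ.continuous.tendsto g).comp hlim1) ?_
    refine hlim2.congr fun n => (heq n).symm

theorem exists_adjoint {Ω : Type*} [MeasurableSpace Ω] {μ : Measure Ω} [SigmaFinite μ]
    (T : Lp ℂ 1 μ →ₗ[ℂ] Lp ℂ 1 μ) (hT : ∀ f, ‖T f‖ ≤ ‖f‖) :
    ∃ A : Lp ℂ ∞ μ →ₗ[ℂ] Lp ℂ ∞ μ, (∀ h, ‖A h‖ ≤ ‖h‖) ∧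
      ∀ h g, ∫ x, A h x * g x ∂μ = ∫ x, h x * T g x ∂μ := by
  have key : ∀ h : Lp ℂ ∞ μ, ∃ k : Lp ℂ ∞ μ, ‖k‖ ≤ ‖h‖ ∧
      ∀ g, ∫ x, k x * g x ∂μ = ∫ x, h x * T g x ∂μ := by
    intro h
    let Tc : Lp ℂ 1 μ →L[ℂ] Lp ℂ 1 μ := T.mkContinuous 1 (fun f => by simpa using hT f)
    let φ : Lp ℂ 1 μ →L[ℂ] ℂ := ((ContinuousLinearMap.mul ℂ ℂ).lpPairing μ ∞ 1 h) ∘L Tc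
    have hφ : ∀ g, φ g = ∫ x, h x * T g x ∂μ := fun g =>
      (ContinuousLinearMap.mul ℂ ℂ).lpPairing_eq_integral h (Tc g)
    obtain ⟨k, hk, hk'⟩ := exists_Linf_of_functional φ (C := ‖h‖) (fun g => by
      rw [hφ]
      exact (norm_integral_mul_le h (T g)).trans (by gcongr; exact hT g)) (norm_nonneg h)
    exact ⟨k, hk, fun g => by rw [← hk', hφ]⟩
  choose A hA1 hA2 using key
  refine ⟨{ toFun := A, map_add' := fun h h' => ?_, map_smul' := fun c h => ?_ }, hA1, hA2⟩
  · refine Linf_eq_of_pairing fun g _ => ?_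
    rw [hA2, integral_mul_add, integral_mul_add, hA2, hA2]
  · refine Linf_eq_of_pairing fun g _ => ?_
    rw [hA2, RingHom.id_apply, integral_mul_smul, integral_mul_smul, hA2]

theorem IsDunfordSchwartz.eLpNorm_adjoint_le {Ω : Type*} [MeasurableSpace Ω] {μ : Measure Ω}
    [SigmaFinite μ] {T : Lp ℂ 1 μ →ₗ[ℂ] Lp ℂ 1 μ} (hT : IsDunfordSchwartz T)
    {h k : Lp ℂ ∞ μ} (H : ∀ g, ∫ x, k x * g x ∂μ = ∫ x, h x * T g x ∂μ) :
    eLpNorm k 1 μ ≤ eLpNorm h 1 μ := by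
  by_cases hh1 : eLpNorm h 1 μ = ∞
  · rw [hh1]; exact le_top
  have hh : Integrable h μ := memLp_one_iff_integrable.1 ⟨(Lp.memLp h).1, lt_top_iff_ne_top.2 hh1⟩
  rw [eLpNorm_one_eq_lintegral_enorm]
  refine lintegral_le_of_forall_fin_meas_le _ fun s hs hμs => ?_
  have hμs' := lt_top_iff_ne_top.2 hμs
  have hu1 := memLp_sgn (k : Ω →ₘ[μ] ℂ) s hs hμs' 1
  have hui := memLp_sgn (k : Ω →ₘ[μ] ℂ) s hs hμs' ∞
  have : Fact (μ s < ∞) := ⟨hμs'⟩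
  have ik : Integrable (fun x => ‖k x‖) (μ.restrict s) :=
    (((Lp.memLp k).restrict s).integrable le_top).norm
  have e1 : ∫ x, h x * T (hu1.toLp _) x ∂μ = ((∫ x in s, ‖k x‖ ∂μ : ℝ) : ℂ) := by
    rw [← H, ← integral_complex_ofReal, ← integral_indicator hs]
    refine integral_congr_ae ?_
    filter_upwards [hu1.coeFn_toLp] with x hx
    rw [hx]
    by_cases hxs : x ∈ s
    · simp only [Set.indicator_of_mem hxs]
      by_cases h0 : k x = 0
      · simp [h0]
      · have : (‖k x‖ : ℂ) ≠ 0 := by simpa using h0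
        rw [← mul_div_assoc, Complex.mul_conj', sq, mul_div_assoc, div_self this, mul_one]
    · simp [hxs]
  have hT1 : ∀ᵐ x ∂μ, ‖T (hu1.toLp _) x‖ₑ ≤ 1 := by
    have b1 := hT.eLpNorm_top_le (hu1.toLp _) (hui.ae_eq hu1.coeFn_toLp.symm)
    have b2 : eLpNorm (hu1.toLp _) ∞ μ ≤ 1 := by
      rw [eLpNorm_congr_ae hu1.coeFn_toLp, eLpNorm_exponent_top, ← ENNReal.ofReal_one]
      refine eLpNormEssSup_le_of_ae_bound (.of_forall fun x => ?_)
      by_cases hxs : x ∈ s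
      · simp only [Set.indicator_of_mem hxs, norm_div, RCLike.norm_conj, Complex.norm_real, norm_norm]
        exact div_self_le_one _
      · simp [hxs]
    rw [eLpNorm_exponent_top] at b1
    filter_upwards [ae_le_eLpNormEssSup (f := T (hu1.toLp _)) (μ := μ)] with x hx
    exact hx.trans (b1.trans b2)
  calc ∫⁻ x in s, ‖k x‖ₑ ∂μ = ENNReal.ofReal (∫ x in s, ‖k x‖ ∂μ) := by
        rw [ofReal_integral_eq_lintegral_ofReal ik (.of_forall fun _ => norm_nonneg _)]
        simp only [ofReal_norm]
    _ ≤ ‖∫ x, h x * T (hu1.toLp _) x ∂μ‖ₑ := by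
        rw [e1, ← ofReal_norm, Complex.norm_real]
        exact ENNReal.ofReal_le_ofReal (le_abs_self _)
    _ ≤ ∫⁻ x, ‖h x * T (hu1.toLp _) x‖ₑ ∂μ := enorm_integral_le_lintegral_enorm _
    _ ≤ ∫⁻ x, ‖h x‖ₑ ∂μ := by
        refine lintegral_mono_ae ?_
        filter_upwards [hT1] with x hx
        rw [enorm_mul]
        exact mul_le_of_le_one_right' hx
    _ = eLpNorm h 1 μ := eLpNorm_one_eq_lintegral_enorm.symm

/-- `L¹ ∩ L^∞` as a subspace of `L¹`. -/
noncomputable def boundedL1 {Ω : Type*} [MeasurableSpace Ω] (μ : Measure Ω) : Submodule ℂ (Lp ℂ 1 μ) where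
  carrier := {f | (f : Ω →ₘ[μ] ℂ) ∈ Lp.LpSubmodule ℂ ℂ ∞ μ}
  add_mem' hf hg := (Lp.LpSubmodule ℂ ℂ ∞ μ).add_mem hf hg
  zero_mem' := (Lp.LpSubmodule ℂ ℂ ∞ μ).zero_mem
  smul_mem' c _ hf := (Lp.LpSubmodule ℂ ℂ ∞ μ).smul_mem c hf

theorem mem_boundedL1 {Ω : Type*} [MeasurableSpace Ω] {μ : Measure Ω} {f : Lp ℂ 1 μ} :
    f ∈ boundedL1 μ ↔ MemLp f ∞ μ := Lp.mem_Lp_iff_memLp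

/-- The inclusion `L¹ ∩ L^∞ ⊆ L^∞`. -/
noncomputable def boundedL1ToLinf {Ω : Type*} [MeasurableSpace Ω] (μ : Measure Ω) :
    boundedL1 μ →ₗ[ℂ] Lp ℂ ∞ μ where
  toFun f := ⟨f.1.1, f.2⟩
  map_add' _ _ := rfl
  map_smul' _ _ := rfl

theorem denseRange_boundedL1 {Ω : Type*} [MeasurableSpace Ω] (μ : Measure Ω) :
    DenseRange (boundedL1 μ).subtype := by
  have : Dense (boundedL1 μ : Set (Lp ℂ 1 μ)) := by
    refine (Lp.simpleFunc.dense (E := ℂ) (μ := μ) ENNReal.one_ne_top).mono fun f hf => ?_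
    refine mem_boundedL1.2 ?_
    exact ((Lp.simpleFunc.toSimpleFunc ⟨f, hf⟩).memLp_top μ).ae_eq
      (Lp.simpleFunc.toSimpleFunc_eq_toFun ⟨f, hf⟩)
  simpa [DenseRange] using this

theorem exists_extension_of_bound {Ω : Type*} [MeasurableSpace Ω] {μ : Measure Ω}
    (A : Lp ℂ ∞ μ →ₗ[ℂ] Lp ℂ ∞ μ) (hA : ∀ h, eLpNorm (A h) 1 μ ≤ eLpNorm h 1 μ) :
    ∃ B : Lp ℂ 1 μ →ₗ[ℂ] Lp ℂ 1 μ, (∀ f, ‖B f‖ ≤ ‖f‖) ∧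
      ∀ f : boundedL1 μ, B f.1 =ᵐ[μ] A (boundedL1ToLinf μ f) := by
  let A₀ : boundedL1 μ →ₗ[ℂ] Lp ℂ 1 μ :=
    { toFun := fun f => ⟨(A (boundedL1ToLinf μ f)).1,
        (hA (boundedL1ToLinf μ f)).trans_lt (Lp.eLpNorm_lt_top f.1)⟩
      map_add' := fun f g => Subtype.ext
        (congrArg (fun k : Lp ℂ ∞ μ => (k : Ω →ₘ[μ] ℂ)) ((A.comp (boundedL1ToLinf μ)).map_add f g))
      map_smul' := fun c f => Subtype.ext
        (congrArg (fun k : Lp ℂ ∞ μ => (k : Ω →ₘ[μ] ℂ)) ((A.comp (boundedL1ToLinf μ)).map_smul c f)) }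
  have hA₀ : ∀ f, ‖A₀ f‖ ≤ 1 * ‖(boundedL1 μ).subtype f‖ := fun f => by
    rw [one_mul, Lp.norm_def, Lp.norm_def]
    exact ENNReal.toReal_mono (Lp.eLpNorm_ne_top _) (hA (boundedL1ToLinf μ f))
  refine ⟨(A₀.extendOfNorm (boundedL1 μ).subtype).toLinearMap, fun f => ?_, fun f => ?_⟩
  · have := LinearMap.norm_extendOfNorm_apply_le (denseRange_boundedL1 μ) 1 hA₀ f
    rwa [one_mul] at this
  · have : A₀.extendOfNorm (boundedL1 μ).subtype f.1 = A₀ f :=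
      LinearMap.extendOfNorm_eq (denseRange_boundedL1 μ) ⟨1, hA₀⟩ f
    rw [ContinuousLinearMap.coe_coe, this]
    exact .of_forall fun _ => rfl

theorem IsDunfordSchwartz.exists_Linf_operator {Ω : Type*} [MeasurableSpace Ω] {μ : Measure Ω}
    [SigmaFinite μ] {T : Lp ℂ 1 μ →ₗ[ℂ] Lp ℂ 1 μ} (hT : IsDunfordSchwartz T) :
    ∃ (R : Lp ℂ ∞ μ →ₗ[ℂ] Lp ℂ ∞ μ) (B : Lp ℂ 1 μ →ₗ[ℂ] Lp ℂ 1 μ), (∀ h, ‖R h‖ ≤ ‖h‖) ∧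
      (∀ h g, ∫ x, R h x * g x ∂μ = ∫ x, h x * B g x ∂μ) ∧
      ∀ f : boundedL1 μ, (R (boundedL1ToLinf μ f)).1 = (T f.1).1 := by
  obtain ⟨A, -, hA⟩ := exists_adjoint T hT.norm_le
  obtain ⟨B, hB1, hB2⟩ := exists_extension_of_bound A fun h => hT.eLpNorm_adjoint_le (hA h)
  obtain ⟨R, hR1, hR2⟩ := exists_adjoint B hB1
  refine ⟨R, B, hR1, hR2, fun f => ?_⟩
  have hTf : T f.1 ∈ boundedL1 μ := mem_boundedL1.2 ⟨(Lp.memLp (T f.1)).1,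
    (hT.eLpNorm_top_le f.1 (mem_boundedL1.1 f.2)).trans_lt (mem_boundedL1.1 f.2).2⟩
  have : R (boundedL1ToLinf μ f) = boundedL1ToLinf μ ⟨T f.1, hTf⟩ := by
    refine Linf_eq_of_pairing fun g hg => ?_
    have hg' := mem_boundedL1.2 hg
    rw [hR2]
    have e1 : ∫ x, boundedL1ToLinf μ f x * B g x ∂μ
        = ∫ x, A (boundedL1ToLinf μ ⟨g, hg'⟩) x * f.1 x ∂μ := by
      refine integral_congr_ae ?_
      filter_upwards [hB2 ⟨g, hg'⟩] with x hx
      rw [← hx, mul_comm]; rfl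
    have e2 : ∫ x, boundedL1ToLinf μ ⟨g, hg'⟩ x * T f.1 x ∂μ
        = ∫ x, boundedL1ToLinf μ ⟨T f.1, hTf⟩ x * g x ∂μ :=
      integral_congr_ae (.of_forall fun x => mul_comm _ _)
    rw [e1, hA, e2]
  exact congrArg (fun k : Lp ℂ ∞ μ => (k : Ω →ₘ[μ] ℂ)) this

theorem IsDunfordSchwartz.exists_extension {Ω : Type*} [MeasurableSpace Ω] {μ : Measure Ω}
    [SigmaFinite μ] {T : Lp ℂ 1 μ →ₗ[ℂ] Lp ℂ 1 μ} (hT : IsDunfordSchwartz T) :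
    ∃ S, IsExtension T S := by
  obtain ⟨R, B, hR1, hR2, hRT⟩ := hT.exists_Linf_operator
  let P : (Ω →ₘ[μ] ℂ) →ₗ.[ℂ] L1AddLinf μ :=
    ⟨Lp.LpSubmodule ℂ ℂ 1 μ, (inclOne μ).comp
      ({ toFun := fun f => T ⟨f.1, f.2⟩
         map_add' := fun f g => T.map_add ⟨f.1, f.2⟩ ⟨g.1, g.2⟩
         map_smul' := fun c f => T.map_smul c ⟨f.1, f.2⟩ } :
        Lp.LpSubmodule ℂ ℂ 1 μ →ₗ[ℂ] Lp ℂ 1 μ)⟩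
  let Q : (Ω →ₘ[μ] ℂ) →ₗ.[ℂ] L1AddLinf μ :=
    ⟨Lp.LpSubmodule ℂ ℂ ∞ μ, (inclTop μ).comp
      ({ toFun := fun f => R ⟨f.1, f.2⟩
         map_add' := fun f g => R.map_add ⟨f.1, f.2⟩ ⟨g.1, g.2⟩
         map_smul' := fun c f => R.map_smul c ⟨f.1, f.2⟩ } :
        Lp.LpSubmodule ℂ ℂ ∞ μ →ₗ[ℂ] Lp ℂ ∞ μ)⟩
  have hPQ : ∀ (x : P.domain) (y : Q.domain), (x : Ω →ₘ[μ] ℂ) = y → P x = Q y := by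
    rintro ⟨x, hx⟩ ⟨y, hy⟩ (rfl : x = y)
    exact Subtype.ext (hRT ⟨⟨x, hx⟩, hy⟩).symm
  refine ⟨(P.sup Q hPQ).toFun, fun f => ?_, R, fun h => ?_, hR1, ?_⟩
  · have := LinearPMap.sup_apply hPQ ⟨f.1, f.2⟩ 0 (inclOne μ f) (add_zero _)
    rw [Q.map_zero, add_zero] at this
    exact this
  · have := LinearPMap.sup_apply hPQ 0 ⟨h.1, h.2⟩ (inclTop μ h) (zero_add _)
    rw [P.map_zero, zero_add] at this
    exact this
  · let _ := weakStar μ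
    refine continuous_induced_rng.2 (continuous_pi fun g => ?_)
    have : Continuous fun h : Lp ℂ ∞ μ => ∫ x, h x * B g x ∂μ :=
      (continuous_apply (B g)).comp (continuous_induced_dom
        (f := fun (h : Lp ℂ ∞ μ) (g : Lp ℂ 1 μ) => ∫ x, h x * g x ∂μ))
    exact this.congr fun h => (hR2 h g).symm

theorem IsExtension.unique {Ω : Type*} [MeasurableSpace Ω] {μ : Measure Ω}
    [SigmaFinite μ] {T : Lp ℂ 1 μ →ₗ[ℂ] Lp ℂ 1 μ} {S S' : L1AddLinf μ →ₗ[ℂ] L1AddLinf μ}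
    (hS : IsExtension T S) (hS' : IsExtension T S') : S = S' := by
  obtain ⟨R, hR, -, hRc⟩ := hS.exists_restrict
  obtain ⟨R', hR', -, hRc'⟩ := hS'.exists_restrict
  have hinj : Function.Injective (inclTop μ) := fun a b hab => Subtype.ext (congrArg (fun z : L1AddLinf μ => (z : Ω →ₘ[μ] ℂ)) hab)
  have hRR : ∀ h, R h = R' h := by
    intro h
    let s := spanningSets μ
    have hsi : ∀ n, MemLp ((s n).indicator h) ∞ μ := fun n =>
      (Lp.memLp h).indicator (measurableSet_spanningSets μ n)
    have hs1 : ∀ n, MemLp ((s n).indicator h) 1 μ := fun n => by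
      have : Fact (μ (s n) < ∞) := ⟨measure_spanningSets_lt_top μ n⟩
      rw [memLp_indicator_iff_restrict (measurableSet_spanningSets μ n)]
      exact ((Lp.memLp h).restrict (s n)).mono_exponent le_top
    have hagree : ∀ n, R (hsi n).toLp = R' (hsi n).toLp := fun n => by
      have e : inclTop μ (hsi n).toLp = inclOne μ (hs1 n).toLp := Subtype.ext rfl
      apply hinj
      rw [← hR, ← hR', e, hS.map_inclOne, hS'.map_inclOne]
    have hlim : Tendsto (fun n => (hsi n).toLp) atTop (@nhds _ (weakStar μ) h) := by
      rw [weakStar, nhds_induced, tendsto_comap_iff, tendsto_pi_nhds]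
      intro g
      have : Tendsto (fun n => ∫ x, (s n).indicator h x * g x ∂μ) atTop
          (𝓝 (∫ x, h x * g x ∂μ)) := by
        refine tendsto_integral_of_dominated_convergence (fun x => ‖h x * g x‖)
          (fun n => (hsi n).1.mul (Lp.memLp g).1) (integrable_mul_Lp h g).norm
          (fun n => .of_forall fun x => ?_) (.of_forall fun x => ?_)
        · by_cases hx : x ∈ s n <;> simp [hx]; positivity
        · refine tendsto_const_nhds.congr' ?_
          filter_upwards [eventually_mem_spanningSets μ x] with n hn
          rw [Set.indicator_of_mem hn]
      refine this.congr fun n => integral_congr_ae ?_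
      filter_upwards [(hsi n).coeFn_toLp] with x hx
      rw [hx]
    have ev : ∀ (R : Lp ℂ ∞ μ → Lp ℂ ∞ μ), Continuous[weakStar μ, weakStar μ] R →
        ∀ g : Lp ℂ 1 μ, Tendsto (fun n => ∫ x, R (hsi n).toLp x * g x ∂μ) atTop
          (𝓝 (∫ x, R h x * g x ∂μ)) := by
      intro R hRc g
      let _ := weakStar μ
      have h1 := (hRc.tendsto h).comp hlim
      have h2 : Continuous fun h : Lp ℂ ∞ μ => ∫ x, h x * g x ∂μ :=
        (continuous_apply g).comp (continuous_induced_dom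
          (f := fun (h : Lp ℂ ∞ μ) (g : Lp ℂ 1 μ) => ∫ x, h x * g x ∂μ))
      exact (h2.tendsto _).comp h1
    refine Linf_eq_of_pairing fun g _ => tendsto_nhds_unique (ev R hRc g) ?_
    simpa only [hagree] using ev R' hRc' g
  ext1 ⟨x, hx⟩
  obtain ⟨f, hf, h, hh, rfl⟩ := Submodule.mem_sup.1 hx
  have : (⟨f + h, hx⟩ : L1AddLinf μ) = inclOne μ ⟨f, hf⟩ + inclTop μ ⟨h, hh⟩ := Subtype.ext rfl
  rw [this, map_add, map_add, hS.map_inclOne, hS'.map_inclOne, hR, hR', hRR]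

/-- Every Dunford–Schwartz operator has exactly one extension to `L¹ + L^∞`. -/
theorem IsDunfordSchwartz.existsUnique_extension {Ω : Type*} [MeasurableSpace Ω] {μ : Measure Ω}
    [SigmaFinite μ] {T : Lp ℂ 1 μ →ₗ[ℂ] Lp ℂ 1 μ} (hT : IsDunfordSchwartz T) :
    ∃! S, IsExtension T S :=
  let ⟨S, hS⟩ := hT.exists_extension
  ⟨S, hS, fun _ hS' => hS'.unique hS⟩

/-- The extension of a Dunford–Schwartz operator to `L¹ + L^∞`. -/
noncomputable def IsDunfordSchwartz.extension {Ω : Type*} [MeasurableSpace Ω] {μ : Measure Ω}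
    [SigmaFinite μ] {T : Lp ℂ 1 μ →ₗ[ℂ] Lp ℂ 1 μ} (hT : IsDunfordSchwartz T) :
    L1AddLinf μ →ₗ[ℂ] L1AddLinf μ :=
  hT.existsUnique_extension.choose

theorem IsDunfordSchwartz.isExtension_extension {Ω : Type*} [MeasurableSpace Ω] {μ : Measure Ω}
    [SigmaFinite μ] {T : Lp ℂ 1 μ →ₗ[ℂ] Lp ℂ 1 μ} (hT : IsDunfordSchwartz T) :
    IsExtension T hT.extension :=
  hT.existsUnique_extension.choose_spec.1

/-! ### The averages and their convergence -/

/-- The space `R_μ` of all `f ∈ L¹ + L^∞` with `μ {|f| > c} < ∞` for every `c > 0`. -/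
def Rmu {Ω : Type*} [MeasurableSpace Ω] (μ : Measure Ω) : Set (L1AddLinf μ) :=
  {f | ∀ c : ℝ, 0 < c → μ {x | c < ‖(f : Ω →ₘ[μ] ℂ) x‖} < ∞}

/-- Almost uniform convergence (in Egorov's sense) of a sequence in `L⁰`. -/
def TendstoAU {Ω : Type*} [MeasurableSpace Ω] {μ : Measure Ω} (F : ℕ → Ω →ₘ[μ] ℂ)
    (f : Ω →ₘ[μ] ℂ) : Prop :=
  ∀ ε : ℝ, 0 < ε → ∃ G : Set Ω, MeasurableSet G ∧ μ Gᶜ ≤ ENNReal.ofReal ε ∧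
    Tendsto (fun n => eLpNorm (G.indicator (f - F n : Ω →ₘ[μ] ℂ)) ∞ μ) atTop (𝓝 0)

/-- `P(k) = ∑_{j=1}^s z_j λ_j^k` with `z_j ∈ ℂ` and `|λ_j| = 1`. -/
def IsTrigPolynomial (P : ℤ → ℂ) : Prop :=
  ∃ (s : ℕ) (z : Fin s → ℂ) (l : Fin s → Circle), ∀ k : ℤ, P k = ∑ j, z j * (l j : ℂ) ^ k

/-- Bounded Besicovitch sequences; the upper limit is taken in the extended reals. -/
def IsBoundedBesicovitch (β : ℕ → ℂ) : Prop :=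
  (∃ C : ℝ, ∀ k, ‖β k‖ ≤ C) ∧
    ∀ ε : ℝ, 0 < ε → ∃ P : ℤ → ℂ, IsTrigPolynomial P ∧
      limsup (fun n : ℕ => (((1 / n : ℝ) * ∑ k ∈ Finset.range n, ‖β k - P k‖ : ℝ) : EReal)) atTop
        < (ε : EReal)

/-- The weighted averages `(1/n) ∑_{k<n} β_k S^k f`. -/
noncomputable def weightedAverage {Ω : Type*} [MeasurableSpace Ω] {μ : Measure Ω}
    (S : L1AddLinf μ →ₗ[ℂ] L1AddLinf μ) (β : ℕ → ℂ) (n : ℕ) (f : L1AddLinf μ) : L1AddLinf μ :=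
  (1 / n : ℂ) • ∑ k ∈ Finset.range n, β k • (S ^ k) f

end DunfordSchwartz

namespace DunfordSchwartz

/-! ### Truncation -/

/-! The proof follows Banach's principle: a maximal inequality reduces almost uniform convergence to
a class of good functions, here $L^1\cap L^\infty$.

The maximal inequality, `IsDunfordSchwartz.maximal_inequality`, comes from a filling scheme that
works for complex functions and needs no positivity of $T$. Give every point a room of size $a$,
fill in as much of $f$ as fits, apply $T$ to the excess, and repeat. What is filled in at a point
has total modulus at most $a$, and the $L^1$ norms of the filled pieces add up to at most $\|f\|_1$.
Hence the set where the room is exhausted has measure at most $\|f\|_1/a$. Elsewhere every excess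
vanishes, and the $L^\infty$ contractivity of $T$ bounds the weighted averages by $Ca$ when
$|\beta_k|\le C$. The exceptional set depends neither on the weights nor on $n$.

For unweighted averages of $v\in L^1\cap L^\infty$, `IsBicontraction.norm_L2_le` makes $T$ a
contraction for $\|\cdot\|_2$, and the mean ergodic theorem gives an $L^2$ limit $u$. A function
that is small in $L^2$ is a sum of small parts in $L^1$ and $L^\infty$, so the maximal inequality
applies to it. With $w=A_mv$, the average $A_nv$ splits into $A_n(v-w)$, which is $O(1/n)$ in
$L^\infty$ because $v-w$ is a bounded coboundary, $A_n(w-u)$, controlled for all $n$ at once, and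
$A_nu=u$; see `IsContractiveExtension.auCauchy_average`.

A weight $\lambda^k$ is absorbed by replacing $T$ with $\lambda T$; linearity gives trigonometric
polynomials. For bounded $v$ a Besicovitch weight is replaced by a polynomial at a uniformly small
cost. A general $f\in\mathcal R_\mu$ differs from some $v\in L^1\cap L^\infty$ by a sum of small
parts in $L^1$ and $L^\infty$, and the maximal inequality finishes the convergence. Finally the
limit is uniformly close to integrable functions, by Fatou's lemma, and this places it in $\mathcal
R_\mu$. -/

/-- The point of modulus at most `r` on the segment `[0, z]` which is closest to `z`. -/
noncomputable def truncate (r : ℝ) (z : ℂ) : ℂ := if ‖z‖ ≤ r then z else ((r / ‖z‖ : ℝ) : ℂ) * z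

theorem norm_truncate_le {r : ℝ} (hr : 0 ≤ r) (z : ℂ) : ‖truncate r z‖ ≤ r := by
  unfold truncate
  split_ifs with h
  · exact h
  · have hz : 0 < ‖z‖ := hr.trans_lt (not_le.1 h)
    rw [norm_mul, Complex.norm_real, Real.norm_of_nonneg (by positivity), div_mul_cancel₀ _ hz.ne']

/-- Both parts are nonnegative multiples of $z$, so the triangle inequality is an equality. This is
why filling loses no $L^1$ norm. -/
theorem norm_truncate_add {r : ℝ} (hr : 0 ≤ r) (z : ℂ) :
    ‖truncate r z‖ + ‖z - truncate r z‖ = ‖z‖ := by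
  unfold truncate
  split_ifs with h
  · simp
  · have hz : 0 < ‖z‖ := hr.trans_lt (not_le.1 h)
    have h1 : r / ‖z‖ ≤ 1 := (div_le_one hz).2 (not_le.1 h).le
    have h2 : z - ((r / ‖z‖ : ℝ) : ℂ) * z = ((1 - r / ‖z‖ : ℝ) : ℂ) * z := by push_cast; ring
    rw [h2, norm_mul, norm_mul, Complex.norm_real, Complex.norm_real,
      Real.norm_of_nonneg (by positivity), Real.norm_of_nonneg (by linarith)]
    ring

theorem norm_truncate_of_ne {r : ℝ} (hr : 0 ≤ r) {z : ℂ} (h : truncate r z ≠ z) :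
    ‖truncate r z‖ = r := by
  unfold truncate at h ⊢
  split_ifs at h ⊢ with h'
  · exact absurd rfl h
  · have hz : 0 < ‖z‖ := hr.trans_lt (not_le.1 h')
    rw [norm_mul, Complex.norm_real, Real.norm_of_nonneg (by positivity), div_mul_cancel₀ _ hz.ne']

theorem measurable_truncate {Ω : Type*} [MeasurableSpace Ω] {r : Ω → ℝ} {h : Ω → ℂ}
    (hr : Measurable r) (hh : Measurable h) : Measurable fun x => truncate (r x) (h x) := by
  unfold truncate
  exact Measurable.ite (measurableSet_le hh.norm hr) hh
    ((Complex.measurable_ofReal.comp (hr.div hh.norm)).mul hh)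

/-! ### The filling scheme -/

section Filling

variable {Ω : Type*} [MeasurableSpace Ω] {μ : Measure Ω}

/-- The room that may still be filled at each point. -/
abbrev Room (Ω : Type*) [MeasurableSpace Ω] := {ρ : Ω → ℝ // Measurable ρ ∧ ∀ x, 0 ≤ ρ x}

theorem memLp_truncate (ρ : Room Ω) (h : Lp ℂ 1 μ) :
    MemLp (fun x => truncate (ρ.1 x) (h x)) 1 μ := by
  refine (Lp.memLp h).mono (measurable_truncate ρ.2.1
    (Lp.stronglyMeasurable h).measurable).aestronglyMeasurable (.of_forall fun x => ?_)
  have := norm_truncate_add (ρ.2.2 x) (h x)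
  have := norm_nonneg (h x - truncate (ρ.1 x) (h x))
  linarith

/-- The part of `h` which fits into the room `ρ`. -/
noncomputable def fill (ρ : Room Ω) (h : Lp ℂ 1 μ) : Lp ℂ 1 μ := (memLp_truncate ρ h).toLp

theorem coeFn_fill (ρ : Room Ω) (h : Lp ℂ 1 μ) :
    fill ρ h =ᵐ[μ] fun x => truncate (ρ.1 x) (h x) := (memLp_truncate ρ h).coeFn_toLp

/-- The room that is left when as much as possible of `h` has been filled into `ρ`. -/
noncomputable def roomLeft (ρ : Room Ω) (h : Lp ℂ 1 μ) : Room Ω :=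
  ⟨fun x => ρ.1 x - ‖truncate (ρ.1 x) (h x)‖,
    ρ.2.1.sub (measurable_truncate ρ.2.1 (Lp.stronglyMeasurable h).measurable).norm,
    fun x => sub_nonneg.2 (norm_truncate_le (ρ.2.2 x) _)⟩

/-- The filling scheme: the room before the step `k`, and the function to be filled into it. -/
noncomputable def filling (T : Lp ℂ 1 μ →ₗ[ℂ] Lp ℂ 1 μ) (ρ : Room Ω) (f : Lp ℂ 1 μ) :
    ℕ → Room Ω × Lp ℂ 1 μ
  | 0 => (ρ, f)
  | k + 1 =>
    let s := filling T ρ f k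
    (roomLeft s.1 s.2, T (s.2 - fill s.1 s.2))

theorem norm_fill_add (ρ : Room Ω) (h : Lp ℂ 1 μ) : ‖fill ρ h‖ + ‖h - fill ρ h‖ = ‖h‖ := by
  simp only [L1.norm_eq_integral_norm]
  rw [← integral_add (L1.integrable_coeFn _).norm (L1.integrable_coeFn _).norm]
  refine integral_congr_ae ?_
  filter_upwards [coeFn_fill ρ h, Lp.coeFn_sub h (fill ρ h)] with x h1 h2
  rw [h2, Pi.sub_apply, h1]
  exact norm_truncate_add (ρ.2.2 x) _

variable (T : Lp ℂ 1 μ →ₗ[ℂ] Lp ℂ 1 μ) (ρ : Room Ω) (f : Lp ℂ 1 μ)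

/-- What is filled in at the step `k`. -/
noncomputable def filled (k : ℕ) : Lp ℂ 1 μ := fill (filling T ρ f k).1 (filling T ρ f k).2

/-- What does not fit in at the step `k`. -/
noncomputable def excess (k : ℕ) : Lp ℂ 1 μ := (filling T ρ f k).2 - filled T ρ f k

theorem filling_succ_snd (k : ℕ) : (filling T ρ f (k + 1)).2 = T (excess T ρ f k) := rfl

/-- Each step splits the current function into the filled part and the excess, and only the excess
is carried on by $T$. The part filled in at time $i$ must therefore still be moved by the remaining
$k-i$ steps. -/
theorem pow_apply_eq_sum_filled (k : ℕ) :
    (T ^ k) f = ∑ i ∈ Finset.range (k + 1), (T ^ (k - i)) (filled T ρ f i) + excess T ρ f k := by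
  induction k with
  | zero => simp [excess, filling]
  | succ k ih =>
    rw [Finset.sum_range_succ, pow_succ', Module.End.mul_apply, ih, map_add, map_sum]
    have : ∀ i ∈ Finset.range (k + 1),
        T ((T ^ (k - i)) (filled T ρ f i)) = (T ^ (k + 1 - i)) (filled T ρ f i) := fun i hi => by
      rw [Nat.sub_add_comm (Nat.lt_succ_iff.1 (Finset.mem_range.1 hi)), pow_succ',
        Module.End.mul_apply]
    rw [Finset.sum_congr rfl this, ← filling_succ_snd, add_assoc]
    simp [excess]

/-- Mass balance: `norm_fill_add` conserves the norm in each splitting, and $T$ does not increase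
the norm of the excess. -/
theorem sum_norm_filled_le (hT : ∀ g, ‖T g‖ ≤ ‖g‖) (k : ℕ) :
    ∑ i ∈ Finset.range k, ‖filled T ρ f i‖ ≤ ‖f‖ := by
  suffices ∑ i ∈ Finset.range k, ‖filled T ρ f i‖ + ‖(filling T ρ f k).2‖ ≤ ‖f‖ by
    have := norm_nonneg (filling T ρ f k).2
    linarith
  induction k with
  | zero => simp [filling]
  | succ k ih =>
    rw [Finset.sum_range_succ, filling_succ_snd]
    have h1 := hT (excess T ρ f k)
    have h2 := norm_fill_add (filling T ρ f k).1 (filling T ρ f k).2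
    change ‖filled T ρ f k‖ + ‖excess T ρ f k‖ = _ at h2
    linarith

theorem ae_room_add_sum (k : ℕ) : ∀ᵐ x ∂μ, (filling T ρ f k).1.1 x
    + ∑ i ∈ Finset.range k, ‖filled T ρ f i x‖ = ρ.1 x := by
  induction k with
  | zero => simp [filling]
  | succ k ih =>
    filter_upwards [ih, coeFn_fill (filling T ρ f k).1 (filling T ρ f k).2] with x h1 h2
    rw [Finset.sum_range_succ, ← h1, filled, h2]
    simp only [filling, roomLeft]
    ring

theorem antitone_room (x : Ω) : Antitone fun k => (filling T ρ f k).1.1 x :=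
  antitone_nat_of_succ_le fun k => by
    simp only [filling, roomLeft]
    exact sub_le_self _ (norm_nonneg _)

/-- Something is left over at a point only if the filled part used up all the room there, and then
no room remains after step $k$. -/
theorem ae_excess_eq_zero (k : ℕ) :
    ∀ᵐ x ∂μ, (filling T ρ f (k + 1)).1.1 x ≠ 0 → excess T ρ f k x = 0 := by
  filter_upwards [coeFn_fill (filling T ρ f k).1 (filling T ρ f k).2,
    Lp.coeFn_sub (filling T ρ f k).2 (filled T ρ f k)] with x h1 h2 h3
  rw [excess, h2, Pi.sub_apply, filled, h1, sub_eq_zero]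
  by_contra h
  refine h3 ?_
  simp only [filling, roomLeft]
  rw [norm_truncate_of_ne ((filling T ρ f k).1.2.2 x) (fun h' => h h'.symm), sub_self]

end Filling

/-! ### The maximal inequality -/

section Maximal

variable {Ω : Type*} [MeasurableSpace Ω] {μ : Measure Ω} {T : Lp ℂ 1 μ →ₗ[ℂ] Lp ℂ 1 μ}

theorem coeFn_sum_smul {p : ℝ≥0∞} {ι : Type*} (s : Finset ι) (c : ι → ℂ) (g : ι → Lp ℂ p μ) :
    (∑ i ∈ s, c i • g i : Lp ℂ p μ) =ᵐ[μ] fun x => ∑ i ∈ s, c i * g i x := by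
  classical
  induction s using Finset.induction_on with
  | empty => simp only [Finset.sum_empty]; exact Lp.coeFn_zero ℂ p μ
  | insert a s ha ih =>
    simp only [Finset.sum_insert ha]
    filter_upwards [ih, Lp.coeFn_add (c a • g a) (∑ i ∈ s, c i • g i), Lp.coeFn_smul (c a) (g a)]
      with x h1 h2 h3
    rw [h2, Pi.add_apply, h1, h3, Pi.smul_apply, smul_eq_mul]

theorem IsDunfordSchwartz.ae_norm_pow_le (hT : IsDunfordSchwartz T) {g : Lp ℂ 1 μ} {C : ℝ}
    (hg : ∀ᵐ x ∂μ, ‖g x‖ ≤ C) (j : ℕ) : ∀ᵐ x ∂μ, ‖(T ^ j) g x‖ ≤ C := by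
  induction j with
  | zero => simpa using hg
  | succ j ih =>
    -- The constant $C$ may be negative only when $\mu=0$.
    rcases eq_or_ne μ 0 with rfl | h0
    · simp
    have : NeZero μ := ⟨h0⟩
    have hC : 0 ≤ C := by
      obtain ⟨x, hx⟩ := hg.exists
      exact (norm_nonneg _).trans hx
    rw [pow_succ', Module.End.mul_apply]
    have h1 := hT.eLpNorm_top_le ((T ^ j) g) (memLp_top_of_bound (Lp.memLp _).1 C ih)
    have h2 : eLpNorm ((T ^ j) g) ∞ μ ≤ ENNReal.ofReal C := by
      rw [eLpNorm_exponent_top]; exact eLpNormEssSup_le_of_ae_bound ih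
    filter_upwards [ae_le_eLpNormEssSup (f := T ((T ^ j) g)) (μ := μ)] with x hx
    rw [← eLpNorm_exponent_top, ← ofReal_norm] at hx
    exact (ENNReal.ofReal_le_ofReal_iff hC).1 (hx.trans (h1.trans h2))

/-- The maximal inequality of weak type `(1, 1)` for weighted averages. -/
theorem IsDunfordSchwartz.maximal_inequality (hT : IsDunfordSchwartz T) (f : Lp ℂ 1 μ) {a : ℝ}
    (ha : 0 < a) : ∃ G, MeasurableSet G ∧ ENNReal.ofReal a * μ Gᶜ ≤ ENNReal.ofReal ‖f‖ ∧
      ∀ (β : ℕ → ℂ) (C : ℝ), (∀ k, ‖β k‖ ≤ C) → ∀ n : ℕ, ∀ᵐ x ∂μ, x ∈ G →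
        ‖(∑ k ∈ Finset.range n, β k • (T ^ k) f : Lp ℂ 1 μ) x‖ ≤ n * (C * a) := by
  let ρ : Room Ω := ⟨fun _ => a, measurable_const, fun _ => ha.le⟩
  let r : ℕ → Ω → ℝ := fun k => (filling T ρ f k).1.1
  have hrm : ∀ k, Measurable (r k) := fun k => (filling T ρ f k).1.2.1
  have hr0 : ∀ k x, 0 ≤ r k x := fun k => (filling T ρ f k).1.2.2
  let d := filled T ρ f
  let e := excess T ρ f
  have hsum : ∀ m, ∀ᵐ x ∂μ, r m x + ∑ i ∈ Finset.range m, ‖d i x‖ = a := ae_room_add_sum T ρ f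
  -- On `Z k` the filled parts have total modulus exactly $a$, so Chebyshev's argument bounds
  -- $a\,\mu(Z_k)$ by $\sum\|d_i\|_1\le\|f\|_1$.
  let Z : ℕ → Set Ω := fun k => {x | r k x = 0}
  have hZm : ∀ k, MeasurableSet (Z k) := fun k => hrm k (measurableSet_singleton 0)
  have hZmono : Monotone Z := fun i j hij x (hx : r i x = 0) =>
    le_antisymm ((antitone_room T ρ f x hij).trans hx.le) (hr0 j x)
  have hZ : ∀ k, ENNReal.ofReal a * μ (Z k) ≤ ENNReal.ofReal ‖f‖ := fun k => by
    have i1 : ∀ i ∈ Finset.range k, Integrable (fun x => ‖d i x‖) μ :=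
      fun i _ => (L1.integrable_coeFn _).norm
    have e1 : ∫ x, ∑ i ∈ Finset.range k, ‖d i x‖ ∂μ ≤ ‖f‖ := by
      rw [integral_finsetSum _ i1]
      simp only [← L1.norm_eq_integral_norm]
      exact sum_norm_filled_le T ρ f hT.norm_le k
    refine le_trans ?_ (ENNReal.ofReal_le_ofReal e1)
    rw [ofReal_integral_eq_lintegral_ofReal (integrable_finsetSum _ i1)
      (.of_forall fun x => Finset.sum_nonneg fun _ _ => norm_nonneg _),
      ← lintegral_indicator_const (hZm k)]
    refine lintegral_mono_ae ?_
    filter_upwards [hsum k] with x hx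
    by_cases hxZ : x ∈ Z k
    · rw [Set.indicator_of_mem hxZ]
      refine ENNReal.ofReal_le_ofReal ?_
      have : r k x = 0 := hxZ
      linarith
    · simp [Set.indicator_of_notMem hxZ]
  refine ⟨(⋃ k, Z k)ᶜ, (MeasurableSet.iUnion hZm).compl, ?_, fun β C hβ n => ?_⟩
  · rw [compl_compl, hZmono.measure_iUnion, ENNReal.mul_iSup]
    exact iSup_le hZ
  · have hC : 0 ≤ C := (norm_nonneg _).trans (hβ 0)
    -- `D j` collects every filled part to which exactly $T^j$ is applied. Its modulus is at most
    -- $C\sum_i|d_i|\le Ca$ before $T^j$ acts, so the contraction of $L^\infty$ can be used on the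
    -- whole sum at once.
    let D : ℕ → Lp ℂ 1 μ := fun j => ∑ i ∈ Finset.range (n - j), β (i + j) • d i
    have hD : ∀ j, ∀ᵐ x ∂μ, ‖D j x‖ ≤ C * a := fun j => by
      filter_upwards [coeFn_sum_smul (Finset.range (n - j)) (fun i => β (i + j)) d, hsum (n - j)]
        with x h1 h2
      rw [h1]
      calc ‖∑ i ∈ Finset.range (n - j), β (i + j) * d i x‖
          ≤ ∑ i ∈ Finset.range (n - j), C * ‖d i x‖ := by
            refine norm_sum_le_of_le _ fun i _ => ?_
            rw [norm_mul]; gcongr; exact hβ _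
        _ ≤ C * a := by
            rw [← Finset.mul_sum]
            have := hr0 (n - j) x
            gcongr; linarith
    have hsplit : (∑ k ∈ Finset.range n, β k • (T ^ k) f : Lp ℂ 1 μ)
        = ∑ j ∈ Finset.range n, (1 : ℂ) • (T ^ j) (D j) + ∑ k ∈ Finset.range n, β k • e k := by
      have h1 : ∀ k, β k • (T ^ k) f = ∑ i ∈ Finset.range (k + 1),
          β (i + (k - i)) • (T ^ (k - i)) (d i) + β k • e k := fun k => by
        rw [pow_apply_eq_sum_filled T ρ f k, smul_add, Finset.smul_sum]
        congr 1
        refine Finset.sum_congr rfl fun i hi => ?_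
        rw [Nat.add_sub_of_le (Nat.lt_succ_iff.1 (Finset.mem_range.1 hi))]
      simp only [h1, Finset.sum_add_distrib, one_smul]
      congr 1
      -- The double sum over $i\le k<n$ is reindexed by $i$ and $j=k-i$, and then summed over $j$ on
      -- the outside.
      rw [Finset.sum_range_diag_flip n fun i j => β (i + j) • (T ^ j) (d i)]
      rw [Finset.sum_comm' (t' := Finset.range n) (s' := fun j => Finset.range (n - j))]
      · simp [D, map_sum]
      · intro x y; simp only [Finset.mem_range]; omega
    have hT' : ∀ᵐ x ∂μ, ∀ j, ‖(T ^ j) (D j) x‖ ≤ C * a :=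
      ae_all_iff.2 fun j => hT.ae_norm_pow_le (hD j) j
    filter_upwards [hT', ae_all_iff.2 (ae_excess_eq_zero T ρ f),
      coeFn_sum_smul (Finset.range n) (fun _ => (1 : ℂ)) (fun j => (T ^ j) (D j)),
      coeFn_sum_smul (Finset.range n) β e, Lp.coeFn_add
        (∑ j ∈ Finset.range n, (1 : ℂ) • (T ^ j) (D j)) (∑ k ∈ Finset.range n, β k • e k)]
      with x h1 h2 h3 h4 h5 hx
    -- The room after step $k$ carries the index $k+1$.
    have h6 : ∀ k, e k x = 0 := fun k => h2 k fun h => hx (Set.mem_iUnion.2 ⟨k + 1, h⟩)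
    rw [hsplit, h5, Pi.add_apply, h3, h4]
    simp only [h6, mul_zero, Finset.sum_const_zero, add_zero, one_mul]
    refine (norm_sum_le_of_le _ fun j _ => h1 j).trans ?_
    simp

end Maximal

/-! ### Contractivity on `L²` -/

/-- Log-convexity makes the ratios $z_{k+1}/z_k$ nondecreasing. A first ratio above $1$ would force
geometric growth and contradict boundedness. -/
theorem le_of_sq_le_mul_of_bounded {z : ℕ → ℝ} (h0 : ∀ k, 0 ≤ z k)
    (hz : ∀ k, z (k + 1) ^ 2 ≤ z k * z (k + 2)) {C : ℝ} (hC : ∀ k, z k ≤ C) : z 1 ≤ z 0 := by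
  by_contra! h
  have h00 : 0 < z 0 := by
    rcases (h0 0).lt_or_eq with h' | h'
    · exact h'
    · have := hz 0
      rw [← h', zero_mul] at this
      nlinarith
  set r := z 1 / z 0
  have hr : 1 < r := (one_lt_div h00).2 h
  have key : ∀ k, 0 < z k ∧ r * z k ≤ z (k + 1) := by
    intro k
    induction k with
    | zero => exact ⟨h00, (div_mul_cancel₀ _ h00.ne').le⟩
    | succ k ih =>
      obtain ⟨h1, h2⟩ := ih
      have h3 : 0 < z (k + 1) := by nlinarith
      refine ⟨h3, ?_⟩
      have h4 := hz k
      have h5 : z (k + 1) * (r * z k) ≤ z k * z (k + 2) := by nlinarith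
      nlinarith
  have hpow : ∀ k, r ^ k * z 0 ≤ z k := by
    intro k
    induction k with
    | zero => simp
    | succ k ih =>
      have := (key k).2
      rw [pow_succ']
      nlinarith
  obtain ⟨k, hk⟩ := pow_unbounded_of_one_lt (C / z 0) hr
  rw [div_lt_iff₀ h00] at hk
  linarith [hpow k, hC k]

section L2

variable {Ω : Type*} [MeasurableSpace Ω] {μ : Measure Ω}

theorem exists_ae_bound (f : boundedL1 μ) : ∃ C : ℝ, 0 ≤ C ∧ ∀ᵐ x ∂μ, ‖f.1 x‖ ≤ C :=
  ⟨‖boundedL1ToLinf μ f‖, norm_nonneg _, ae_norm_le_norm (boundedL1ToLinf μ f)⟩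

theorem memLp_two (f : boundedL1 μ) : MemLp f.1 2 μ := by
  obtain ⟨C, hC0, hC⟩ := exists_ae_bound f
  rw [memLp_two_iff_integrable_sq_norm (Lp.memLp f.1).1]
  refine ((L1.integrable_coeFn f.1).norm.const_mul C).mono' ((Lp.memLp f.1).1.norm.pow 2) ?_
  filter_upwards [hC] with x hx
  rw [Real.norm_of_nonneg (by positivity), sq]
  gcongr

/-- The inclusion `L¹ ∩ L^∞ ⊆ L²`. -/
noncomputable def boundedL1ToL2 (μ : Measure Ω) : boundedL1 μ →ₗ[ℂ] Lp ℂ 2 μ where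
  toFun f := ⟨f.1.1, memLp_two f |>.eLpNorm_lt_top⟩
  map_add' _ _ := rfl
  map_smul' _ _ := rfl

theorem norm_sq_boundedL1ToL2_le {f : boundedL1 μ} {C : ℝ} (h : ∀ᵐ x ∂μ, ‖f.1 x‖ ≤ C) :
    ‖boundedL1ToL2 μ f‖ ^ 2 ≤ C * ‖f.1‖ := by
  have h1 : ((‖boundedL1ToL2 μ f‖ ^ 2 : ℝ) : ℂ) = ((∫ x, ‖f.1 x‖ ^ 2 ∂μ : ℝ) : ℂ) := by
    rw [Complex.ofReal_pow, ← Complex.coe_algebraMap, ← inner_self_eq_norm_sq_to_K (𝕜 := ℂ),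
      L2.inner_def, Complex.coe_algebraMap, ← integral_complex_ofReal]
    refine integral_congr_ae (.of_forall fun x => ?_)
    exact inner_self_eq_norm_sq_to_K (𝕜 := ℂ) (f.1 x) |>.trans (by simp)
  rw [Complex.ofReal_inj.1 h1, L1.norm_eq_integral_norm, ← integral_const_mul]
  refine integral_mono_ae ((memLp_two_iff_integrable_sq_norm (Lp.memLp f.1).1).1 (memLp_two f))
    ((L1.integrable_coeFn f.1).norm.const_mul C) ?_
  filter_upwards [h] with x hx
  rw [sq]
  gcongr

/-- Simple functions in $L^2$ are bounded and live on sets of finite measure, hence lie in $L^1\cap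
L^\infty$. -/
theorem denseRange_boundedL1ToL2 (μ : Measure Ω) : DenseRange (boundedL1ToL2 μ) := by
  refine (Lp.simpleFunc.dense (E := ℂ) (μ := μ) (p := 2) (by simp)).mono fun f hf => ?_
  set s := Lp.simpleFunc.toSimpleFunc ⟨f, hf⟩
  have hs : s =ᵐ[μ] f := Lp.simpleFunc.toSimpleFunc_eq_toFun ⟨f, hf⟩
  have h2 : MemLp s 2 μ := (Lp.memLp f).ae_eq hs.symm
  have h1 : MemLp s 1 μ := (SimpleFunc.memLp_iff one_ne_zero ENNReal.one_ne_top).2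
    ((SimpleFunc.memLp_iff two_ne_zero ENNReal.ofNat_ne_top).1 h2)
  have hf1 : MemLp f 1 μ := h1.ae_eq hs
  exact ⟨⟨⟨f.1, Lp.mem_Lp_iff_memLp.2 hf1⟩, mem_boundedL1.2 ((s.memLp_top μ).ae_eq hs)⟩, rfl⟩

/-- Complex conjugation on `L¹ ∩ L^∞`. -/
noncomputable def conjBounded (f : boundedL1 μ) : boundedL1 μ :=
  ⟨star f.1, mem_boundedL1.2 ((mem_boundedL1.1 f.2).star.ae_eq (Lp.coeFn_star f.1).symm)⟩

theorem coeFn_conjBounded (f : boundedL1 μ) : (conjBounded f).1 =ᵐ[μ] fun x => conj (f.1 x) :=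
  Lp.coeFn_star f.1

theorem norm_conjBounded (f : boundedL1 μ) : ‖(conjBounded f).1‖ = ‖f.1‖ := by
  simp only [L1.norm_eq_integral_norm]
  refine integral_congr_ae ?_
  filter_upwards [coeFn_conjBounded f] with x hx
  rw [hx, RCLike.norm_conj]

/-- A map of `L¹ ∩ L^∞` which is contractive for `‖·‖₁` and for `‖·‖_∞`. -/
structure IsBicontraction (X : boundedL1 μ → boundedL1 μ) : Prop where
  norm_le : ∀ f, ‖(X f).1‖ ≤ ‖f.1‖
  ae_bound : ∀ f (C : ℝ), (∀ᵐ x ∂μ, ‖f.1 x‖ ≤ C) → ∀ᵐ x ∂μ, ‖(X f).1 x‖ ≤ C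

/-- The orbit of `f` under the conjugates of `X` and `Y` in turn. -/
noncomputable def altOrbit (X Y : boundedL1 μ → boundedL1 μ) (f : boundedL1 μ) : ℕ → boundedL1 μ
  | 0 => f
  | k + 1 => altOrbit Y X (conjBounded (X f)) k

theorem norm_altOrbit_le (k : ℕ) : ∀ {X Y : boundedL1 μ → boundedL1 μ}, IsBicontraction X →
    IsBicontraction Y → ∀ f, ‖(altOrbit X Y f k).1‖ ≤ ‖f.1‖ := by
  induction k with
  | zero => intro X Y _ _ f; exact le_rfl
  | succ k ih =>
    intro X Y hX hY f
    exact (ih hY hX _).trans ((norm_conjBounded _).le.trans (hX.norm_le f))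

theorem ae_bound_altOrbit (k : ℕ) : ∀ {X Y : boundedL1 μ → boundedL1 μ}, IsBicontraction X →
    IsBicontraction Y → ∀ (f) (C : ℝ), (∀ᵐ x ∂μ, ‖f.1 x‖ ≤ C) →
    ∀ᵐ x ∂μ, ‖(altOrbit X Y f k).1 x‖ ≤ C := by
  induction k with
  | zero => intro X Y _ _ f C h; exact h
  | succ k ih =>
    intro X Y hX hY f C h
    refine ih hY hX _ C ?_
    filter_upwards [coeFn_conjBounded (X f), hX.ae_bound f C h] with x h1 h2
    rwa [h1, RCLike.norm_conj]

theorem inner_conjBounded (f g : boundedL1 μ) :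
    inner ℂ (boundedL1ToL2 μ (conjBounded f)) (boundedL1ToL2 μ g) = ∫ x, f.1 x * g.1 x ∂μ := by
  rw [L2.inner_def]
  refine integral_congr_ae ?_
  filter_upwards [coeFn_conjBounded f] with x hx
  change inner ℂ ((conjBounded f).1 x) (g.1 x) = _
  rw [hx]
  simp [mul_comm]

theorem norm_boundedL1ToL2_conjBounded (f : boundedL1 μ) :
    ‖boundedL1ToL2 μ (conjBounded f)‖ = ‖boundedL1ToL2 μ f‖ := by
  rw [Lp.norm_def, Lp.norm_def]
  congr 1
  refine eLpNorm_congr_norm_ae ?_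
  filter_upwards [coeFn_conjBounded f] with x hx
  change ‖(conjBounded f).1 x‖ = ‖f.1 x‖
  rw [hx, RCLike.norm_conj]

theorem norm_integral_mul_le_L2 (f g : boundedL1 μ) :
    ‖∫ x, f.1 x * g.1 x ∂μ‖ ≤ ‖boundedL1ToL2 μ f‖ * ‖boundedL1ToL2 μ g‖ := by
  rw [← inner_conjBounded, ← norm_boundedL1ToL2_conjBounded f]
  exact norm_inner_le_norm _ _

/-- Conjugation turns the bilinear pairing into the inner product: $\|Xf\|_2^2=\int
Xf\,\overline{Xf}=\int f\,Y(\overline{Xf})$, and Cauchy–Schwarz applies. -/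
theorem norm_sq_le_of_pairing {X Y : boundedL1 μ → boundedL1 μ}
    (H : ∀ f g, ∫ x, (X f).1 x * g.1 x ∂μ = ∫ x, f.1 x * (Y g).1 x ∂μ) (f : boundedL1 μ) :
    ‖boundedL1ToL2 μ (conjBounded (X f))‖ ^ 2
      ≤ ‖boundedL1ToL2 μ f‖ * ‖boundedL1ToL2 μ (conjBounded (Y (conjBounded (X f))))‖ := by
  have h1 : ((‖boundedL1ToL2 μ (conjBounded (X f))‖ ^ 2 : ℝ) : ℂ)
      = ∫ x, f.1 x * (Y (conjBounded (X f))).1 x ∂μ := by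
    rw [← H, ← inner_conjBounded, inner_self_eq_norm_sq_to_K]
    simp
  have h2 := norm_integral_mul_le_L2 f (Y (conjBounded (X f)))
  rw [← h1, Complex.norm_real, Real.norm_of_nonneg (by positivity)] at h2
  rwa [norm_boundedL1ToL2_conjBounded (Y _)]

/-- Log-convexity of the $L^2$ norms along the orbit. The pairing relation is symmetric in $X$ and
$Y$, so the induction may exchange them at every step. -/
theorem norm_sq_altOrbit_le (k : ℕ) : ∀ {X Y : boundedL1 μ → boundedL1 μ},
    (∀ f g, ∫ x, (X f).1 x * g.1 x ∂μ = ∫ x, f.1 x * (Y g).1 x ∂μ) → ∀ f,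
    ‖boundedL1ToL2 μ (altOrbit X Y f (k + 1))‖ ^ 2
      ≤ ‖boundedL1ToL2 μ (altOrbit X Y f k)‖ * ‖boundedL1ToL2 μ (altOrbit X Y f (k + 2))‖ := by
  induction k with
  | zero => intro X Y H f; exact norm_sq_le_of_pairing H f
  | succ k ih =>
    intro X Y H f
    refine ih (X := Y) (Y := X) (fun f g => ?_) _
    simpa only [mul_comm] using (H g f).symm

/-- An operator with a formal adjoint is contractive for `‖·‖₂` if both are contractive for `‖·‖₁`
and for `‖·‖_∞`. -/
theorem IsBicontraction.norm_L2_le {X Y : boundedL1 μ → boundedL1 μ} (hX : IsBicontraction X)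
    (hY : IsBicontraction Y)
    (H : ∀ f g, ∫ x, (X f).1 x * g.1 x ∂μ = ∫ x, f.1 x * (Y g).1 x ∂μ) (f : boundedL1 μ) :
    ‖boundedL1ToL2 μ (X f)‖ ≤ ‖boundedL1ToL2 μ f‖ := by
  obtain ⟨C, hC0, hC⟩ := exists_ae_bound f
  rw [← norm_boundedL1ToL2_conjBounded (X f)]
  -- Along the orbit the $L^1$ and $L^\infty$ bounds of $f$ persist, so the squared $L^2$ norms are
  -- at most $C\|f\|_1$; the added $1$ passes from squares to norms via $2x\le x^2+1$.
  refine le_of_sq_le_mul_of_bounded (z := fun k => ‖boundedL1ToL2 μ (altOrbit X Y f k)‖)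
    (fun k => norm_nonneg _) (fun k => norm_sq_altOrbit_le k H f) (C := C * ‖f.1‖ + 1) fun k => ?_
  have h1 := norm_sq_boundedL1ToL2_le (ae_bound_altOrbit k hX hY f C hC)
  have h2 : C * ‖(altOrbit X Y f k).1‖ ≤ C * ‖f.1‖ := by
    gcongr; exact norm_altOrbit_le k hX hY f
  nlinarith [sq_nonneg (‖boundedL1ToL2 μ (altOrbit X Y f k)‖ - 1)]

variable {T : Lp ℂ 1 μ →ₗ[ℂ] Lp ℂ 1 μ}

/-- The restriction of a Dunford–Schwartz operator to `L¹ ∩ L^∞`. -/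
noncomputable def IsDunfordSchwartz.restrict (hT : IsDunfordSchwartz T) :
    boundedL1 μ →ₗ[ℂ] boundedL1 μ :=
  LinearMap.restrict T (p := boundedL1 μ) (q := boundedL1 μ) fun f hf =>
    mem_boundedL1.2 ⟨(Lp.memLp (T f)).1,
      (hT.eLpNorm_top_le f (mem_boundedL1.1 hf)).trans_lt (mem_boundedL1.1 hf).2⟩

theorem IsDunfordSchwartz.coe_restrict (hT : IsDunfordSchwartz T) (f : boundedL1 μ) :
    (hT.restrict f).1 = T f.1 := rfl

theorem IsDunfordSchwartz.coe_restrict_pow (hT : IsDunfordSchwartz T) (n : ℕ) (f : boundedL1 μ) :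
    ((hT.restrict ^ n) f).1 = (T ^ n) f.1 := by
  induction n with
  | zero => rfl
  | succ n ih => rw [pow_succ', pow_succ', Module.End.mul_apply, Module.End.mul_apply,
      hT.coe_restrict, ih]

theorem IsDunfordSchwartz.isBicontraction_restrict (hT : IsDunfordSchwartz T) :
    IsBicontraction hT.restrict where
  norm_le f := hT.norm_le f.1
  ae_bound f _ h := hT.ae_norm_pow_le (g := f.1) h 1

/-- The adjoint of $T$ contracts $L^\infty$ by duality with $\|\cdot\|_1$, and contracts
$\|\cdot\|_1$ because $T$ contracts $\|\cdot\|_\infty$. The log-convexity argument then takes the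
place of Riesz–Thorin interpolation. -/
theorem IsDunfordSchwartz.norm_restrict_L2_le [SigmaFinite μ] (hT : IsDunfordSchwartz T)
    (f : boundedL1 μ) : ‖boundedL1ToL2 μ (hT.restrict f)‖ ≤ ‖boundedL1ToL2 μ f‖ := by
  obtain ⟨A, hA, hAT⟩ := exists_adjoint T hT.norm_le
  have hA1 : ∀ h, eLpNorm (A h) 1 μ ≤ eLpNorm h 1 μ := fun h => hT.eLpNorm_adjoint_le (hAT h)
  let Y : boundedL1 μ → boundedL1 μ := fun f =>
    ⟨⟨(A (boundedL1ToLinf μ f)).1, (hA1 (boundedL1ToLinf μ f)).trans_lt (Lp.eLpNorm_lt_top f.1)⟩,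
      (A (boundedL1ToLinf μ f)).2⟩
  have hY : IsBicontraction Y :=
    { norm_le := fun f => by
        rw [Lp.norm_def, Lp.norm_def]
        exact ENNReal.toReal_mono (Lp.eLpNorm_ne_top _) (hA1 (boundedL1ToLinf μ f))
      ae_bound := fun f C h => by
        rcases eq_or_ne μ 0 with rfl | h0
        · simp
        have : NeZero μ := ⟨h0⟩
        have hC : 0 ≤ C := by
          obtain ⟨x, hx⟩ := h.exists
          exact (norm_nonneg _).trans hx
        have h1 : ‖boundedL1ToLinf μ f‖ ≤ C := norm_le_of_ae_norm_le hC h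
        filter_upwards [ae_norm_le_norm (A (boundedL1ToLinf μ f))] with x hx
        exact hx.trans ((hA _).trans h1) }
  refine hT.isBicontraction_restrict.norm_L2_le hY (fun f g => ?_) f
  refine Eq.trans ?_ ((hAT (boundedL1ToLinf μ g) f.1).symm.trans ?_)
  · exact integral_congr_ae (.of_forall fun x => mul_comm _ _)
  · exact integral_congr_ae (.of_forall fun x => mul_comm _ _)

/-- The averages of a bounded integrable function converge in `L²`. -/
theorem IsDunfordSchwartz.exists_tendsto_L2 [SigmaFinite μ] (hT : IsDunfordSchwartz T)
    (f : boundedL1 μ) : ∃ u : Lp ℂ 2 μ, Tendsto (fun n : ℕ => boundedL1ToL2 μ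
      ((n : ℂ)⁻¹ • ∑ k ∈ Finset.range n, (hT.restrict ^ k) f)) atTop (𝓝 u) := by
  let F : boundedL1 μ →ₗ[ℂ] Lp ℂ 2 μ := (boundedL1ToL2 μ).comp hT.restrict
  have hF : ∀ f, ‖F f‖ ≤ 1 * ‖boundedL1ToL2 μ f‖ := fun f => by
    rw [one_mul]; exact hT.norm_restrict_L2_le f
  let T₂ : Lp ℂ 2 μ →L[ℂ] Lp ℂ 2 μ := F.extendOfNorm (boundedL1ToL2 μ)
  have hT₂ : ∀ f, T₂ (boundedL1ToL2 μ f) = boundedL1ToL2 μ (hT.restrict f) :=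
    LinearMap.extendOfNorm_eq (denseRange_boundedL1ToL2 μ) ⟨1, hF⟩
  have hn : ‖T₂‖ ≤ 1 := LinearMap.opNorm_extendOfNorm_le (denseRange_boundedL1ToL2 μ) zero_le_one hF
  have hit : ∀ k, T₂^[k] (boundedL1ToL2 μ f) = boundedL1ToL2 μ ((hT.restrict ^ k) f) := by
    intro k
    induction k with
    | zero => rfl
    | succ k ih => rw [Function.iterate_succ_apply', ih, hT₂, pow_succ', Module.End.mul_apply]
  -- Von Neumann's mean ergodic theorem for the contraction of $L^2$ extending $T$.
  refine ⟨_, (T₂.tendsto_birkhoffAverage_orthogonalProjection hn (boundedL1ToL2 μ f)).congr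
    fun n => ?_⟩
  simp only [birkhoffAverage, birkhoffSum, id, hit, map_smul, map_sum]

end L2

/-! ### Almost uniform Cauchy sequences -/

section AlmostUniform

variable {Ω : Type*} [MeasurableSpace Ω] {μ : Measure Ω}

/-- Almost uniform Cauchy sequences in `L⁰`, with one `ε` for the exceptional set and the error. -/
def AUCauchy (F : ℕ → Ω →ₘ[μ] ℂ) : Prop :=
  ∀ ε : ℝ, 0 < ε → ∃ G : Set Ω, MeasurableSet G ∧ μ Gᶜ ≤ ENNReal.ofReal ε ∧
    ∃ N, ∀ m ≥ N, ∀ n ≥ N, ∀ᵐ x ∂μ, x ∈ G → ‖F m x - F n x‖ ≤ ε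

theorem measure_compl_inter_le {G H : Set Ω} {a b : ℝ} (ha : 0 ≤ a) (hb : 0 ≤ b)
    (hG : μ Gᶜ ≤ ENNReal.ofReal a) (hH : μ Hᶜ ≤ ENNReal.ofReal b) :
    μ (G ∩ H)ᶜ ≤ ENNReal.ofReal (a + b) := by
  rw [Set.compl_inter, ENNReal.ofReal_add ha hb]
  exact (measure_union_le _ _).trans (add_le_add hG hH)

/-- The usual $\varepsilon/3$ argument, with the exceptional sets adding up as well. The
approximating sequence may change with $\varepsilon$. -/
theorem AUCauchy.of_approx {F : ℕ → Ω →ₘ[μ] ℂ}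
    (H : ∀ ε : ℝ, 0 < ε → ∃ F' : ℕ → Ω →ₘ[μ] ℂ, AUCauchy F' ∧ ∃ G : Set Ω, MeasurableSet G ∧
      μ Gᶜ ≤ ENNReal.ofReal ε ∧ ∃ N, ∀ n ≥ N, ∀ᵐ x ∂μ, x ∈ G → ‖F n x - F' n x‖ ≤ ε) :
    AUCauchy F := by
  intro ε hε
  obtain ⟨F', hF', G, hGm, hG, N, hN⟩ := H (ε / 3) (by positivity)
  obtain ⟨G', hGm', hG', N', hN'⟩ := hF' (ε / 3) (by positivity)
  refine ⟨G ∩ G', hGm.inter hGm', (measure_compl_inter_le (by positivity) (by positivity) hG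
    hG').trans (ENNReal.ofReal_le_ofReal (by linarith)), max N N', fun m hm n hn => ?_⟩
  filter_upwards [hN m (le_of_max_le_left hm), hN n (le_of_max_le_left hn),
    hN' m (le_of_max_le_right hm) n (le_of_max_le_right hn)] with x h1 h2 h3 hx
  have h1 := h1 hx.1
  have h2 := h2 hx.1
  have h3 := h3 hx.2
  rw [norm_sub_rev] at h2
  calc ‖F m x - F n x‖ = ‖(F m x - F' m x) + (F' m x - F' n x) + (F' n x - F n x)‖ := by ring_nf
    _ ≤ ε / 3 + ε / 3 + ε / 3 := norm_add_le_of_le (norm_add_le_of_le h1 h3) h2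
    _ = ε := by ring

theorem auCauchy_const (f : Ω →ₘ[μ] ℂ) : AUCauchy fun _ => f := fun ε hε =>
  ⟨Set.univ, .univ, by simp, 0, fun _ _ _ _ => .of_forall fun x _ => by simp [hε.le]⟩

theorem AUCauchy.add {F F' : ℕ → Ω →ₘ[μ] ℂ} (hF : AUCauchy F) (hF' : AUCauchy F') :
    AUCauchy fun n => F n + F' n := by
  intro ε hε
  obtain ⟨G, hGm, hG, N, hN⟩ := hF (ε / 2) (by positivity)
  obtain ⟨G', hGm', hG', N', hN'⟩ := hF' (ε / 2) (by positivity)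
  refine ⟨G ∩ G', hGm.inter hGm', (measure_compl_inter_le (by positivity) (by positivity) hG
    hG').trans (ENNReal.ofReal_le_ofReal (by linarith)), max N N', fun m hm n hn => ?_⟩
  filter_upwards [hN m (le_of_max_le_left hm) n (le_of_max_le_left hn),
    hN' m (le_of_max_le_right hm) n (le_of_max_le_right hn), AEEqFun.coeFn_add (F m) (F' m),
    AEEqFun.coeFn_add (F n) (F' n)] with x h1 h2 h3 h4 hx
  rw [h3, h4, Pi.add_apply, Pi.add_apply, add_sub_add_comm]
  exact (norm_add_le_of_le (h1 hx.1) (h2 hx.2)).trans_eq (by ring)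

theorem AUCauchy.smul {F : ℕ → Ω →ₘ[μ] ℂ} (hF : AUCauchy F) (c : ℂ) :
    AUCauchy fun n => c • F n := by
  intro ε hε
  have hpos : 0 < ‖c‖ + 1 := by positivity
  obtain ⟨G, hGm, hG, N, hN⟩ := hF (ε / (‖c‖ + 1)) (by positivity)
  refine ⟨G, hGm, hG.trans (ENNReal.ofReal_le_ofReal ?_), N, fun m hm n hn => ?_⟩
  · exact div_le_self hε.le (by linarith [norm_nonneg c])
  filter_upwards [hN m hm n hn, AEEqFun.coeFn_smul c (F m), AEEqFun.coeFn_smul c (F n)]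
    with x h1 h2 h3 hx
  rw [h2, h3, Pi.smul_apply, Pi.smul_apply, ← smul_sub, norm_smul]
  calc ‖c‖ * ‖F m x - F n x‖ ≤ (‖c‖ + 1) * (ε / (‖c‖ + 1)) := by
        gcongr
        · linarith
        · exact h1 hx
    _ = ε := mul_div_cancel₀ _ hpos.ne'

theorem AUCauchy.sum {ι : Type*} (s : Finset ι) {F : ι → ℕ → Ω →ₘ[μ] ℂ}
    (hF : ∀ i, AUCauchy (F i)) : AUCauchy fun n => ∑ i ∈ s, F i n := by
  classical
  induction s using Finset.induction_on with
  | empty => simpa using auCauchy_const 0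
  | insert a s ha ih => simpa only [Finset.sum_insert ha] using (hF a).add ih

/-- Taking $\varepsilon=2^{-k}$ gives exceptional sets with summable measures. Intersecting the good
sets from index $j$ on leaves a set with small complement on which the sequence is uniformly Cauchy,
for all accuracies simultaneously. -/
theorem AUCauchy.exists_limit {F : ℕ → Ω →ₘ[μ] ℂ} (hF : AUCauchy F) :
    ∃ f : Ω →ₘ[μ] ℂ, TendstoAU F f ∧ ∀ᵐ x ∂μ, Tendsto (fun n => F n x) atTop (𝓝 (f x)) := by
  have hpos : ∀ k : ℕ, (0 : ℝ) < (1 / 2) ^ k := fun k => by positivity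
  choose G hGm hG N hN using fun k : ℕ => hF _ (hpos k)
  have hN' : ∀ᵐ x ∂μ, ∀ k, ∀ m ≥ N k, ∀ n ≥ N k, x ∈ G k → ‖F m x - F n x‖ ≤ (1 / 2) ^ k := by
    simp only [ae_all_iff]
    exact hN
  let H : ℕ → Set Ω := fun j => ⋂ k, G (j + k)
  have hHm : ∀ j, MeasurableSet (H j) := fun j => MeasurableSet.iInter fun k => hGm _
  have hH : ∀ j, μ (H j)ᶜ ≤ ENNReal.ofReal (2 * (1 / 2) ^ j) := fun j => by
    have hs : HasSum (fun k : ℕ => (1 / 2 : ℝ) ^ (j + k)) (2 * (1 / 2) ^ j) := by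
      have := hasSum_geometric_two.mul_left ((1 / 2 : ℝ) ^ j)
      simpa only [← pow_add, mul_comm] using this
    rw [Set.compl_iInter, ← hs.tsum_eq,
      ENNReal.ofReal_tsum_of_nonneg (fun k => (hpos _).le) hs.summable]
    exact (measure_iUnion_le _).trans (ENNReal.tsum_le_tsum fun k => hG _)
  have hlim0 : Tendsto (fun j : ℕ => 2 * (1 / 2 : ℝ) ^ j) atTop (𝓝 0) := by
    simpa using (tendsto_pow_atTop_nhds_zero_of_lt_one (r := (1 / 2 : ℝ)) (by norm_num)
      (by norm_num)).const_mul 2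
  have hex : ∀ᵐ x ∂μ, ∃ j, x ∈ H j := by
    have h0 : μ (⋂ j, (H j)ᶜ) = 0 := by
      refine le_antisymm (ge_of_tendsto' (x := atTop)
        (f := fun j : ℕ => ENNReal.ofReal (2 * (1 / 2 : ℝ) ^ j)) ?_
        fun j => (measure_mono (Set.iInter_subset _ j)).trans (hH j)) zero_le
      simpa using ENNReal.tendsto_ofReal hlim0
    filter_upwards [measure_eq_zero_iff_ae_notMem.1 h0] with x hx
    simpa using hx
  have hcauchy : ∀ᵐ x ∂μ, ∃ l, Tendsto (fun n => F n x) atTop (𝓝 l) := by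
    filter_upwards [hN', hex] with x h1 ⟨j, hj⟩
    refine cauchySeq_tendsto_of_complete (Metric.cauchySeq_iff'.2 fun ε hε => ?_)
    obtain ⟨k, hk⟩ := exists_pow_lt_of_lt_one hε (by norm_num : (1 / 2 : ℝ) < 1)
    refine ⟨N (j + k), fun n hn => ?_⟩
    rw [dist_eq_norm]
    refine (h1 (j + k) n hn _ le_rfl (Set.mem_iInter.1 hj k)).trans_lt (lt_of_le_of_lt ?_ hk)
    exact pow_le_pow_of_le_one (by norm_num) (by norm_num) (Nat.le_add_left k j)
  obtain ⟨g, hgm, hg⟩ := measurable_limit_of_tendsto_metrizable_ae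
    (fun n => (F n).measurable.aemeasurable) hcauchy
  let f : Ω →ₘ[μ] ℂ := AEEqFun.mk g hgm.aestronglyMeasurable
  have hf : ∀ᵐ x ∂μ, Tendsto (fun n => F n x) atTop (𝓝 (f x)) := by
    filter_upwards [hg, AEEqFun.coeFn_mk g hgm.aestronglyMeasurable] with x h1 h2
    rwa [h2]
  refine ⟨f, fun ε hε => ?_, hf⟩
  obtain ⟨j, hj⟩ := (hlim0.eventually (gt_mem_nhds hε)).exists
  refine ⟨H j, hHm j, (hH j).trans (ENNReal.ofReal_le_ofReal hj.le), ?_⟩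
  refine ENNReal.tendsto_nhds_zero.2 fun δ hδ => ?_
  obtain ⟨k, hk⟩ : ∃ k : ℕ, ENNReal.ofReal ((1 / 2) ^ k) < δ := by
    have : Tendsto (fun k : ℕ => ENNReal.ofReal ((1 / 2 : ℝ) ^ k)) atTop (𝓝 0) := by
      simpa using ENNReal.tendsto_ofReal (tendsto_pow_atTop_nhds_zero_of_lt_one (r := (1 / 2 : ℝ))
        (by norm_num) (by norm_num))
    exact (this.eventually (gt_mem_nhds hδ)).exists
  filter_upwards [eventually_ge_atTop (N (j + k))] with n hn
  refine le_trans ?_ hk.le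
  rw [eLpNorm_exponent_top]
  refine eLpNormEssSup_le_of_ae_bound ?_
  filter_upwards [hN', hf, AEEqFun.coeFn_sub f (F n)] with x h1 h2 h3
  by_cases hx : x ∈ H j
  · rw [Set.indicator_of_mem hx, h3, Pi.sub_apply]
    refine le_of_tendsto (h2.sub_const (F n x)).norm ?_
    filter_upwards [eventually_ge_atTop (N (j + k))] with m hm
    refine (h1 (j + k) m hm n hn (Set.mem_iInter.1 hx k)).trans ?_
    exact pow_le_pow_of_le_one (by norm_num) (by norm_num) (Nat.le_add_left k j)
  · rw [Set.indicator_of_notMem hx, norm_zero]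
    positivity

end AlmostUniform

/-! ### Small elements of `L¹ + L^∞` -/

section Small

variable {Ω : Type*} [MeasurableSpace Ω] {μ : Measure Ω}

noncomputable instance : AddCommGroup (L1AddLinf μ) := Submodule.addCommGroup _

/-- `S` extends `T` and is a contraction of `L^∞`. -/
structure IsContractiveExtension (T : Lp ℂ 1 μ →ₗ[ℂ] Lp ℂ 1 μ)
    (S : L1AddLinf μ →ₗ[ℂ] L1AddLinf μ) : Prop where
  isDunfordSchwartz : IsDunfordSchwartz T
  map_inclOne : ∀ f, S (inclOne μ f) = inclOne μ (T f)
  map_inclTop : ∀ h, ∃ k, S (inclTop μ h) = inclTop μ k ∧ ‖k‖ ≤ ‖h‖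

/-- `r` is the sum of functions of norm at most `t` in `L¹` and in `L^∞`. -/
def IsSmall (t : ℝ) (r : L1AddLinf μ) : Prop :=
  ∃ (p : Lp ℂ 1 μ) (q : Lp ℂ ∞ μ), r = inclOne μ p + inclTop μ q ∧ ‖p‖ ≤ t ∧ ‖q‖ ≤ t

theorem IsSmall.add {t t' : ℝ} {r r' : L1AddLinf μ} (h : IsSmall t r) (h' : IsSmall t' r') :
    IsSmall (t + t') (r + r') := by
  obtain ⟨p, q, rfl, hp, hq⟩ := h
  obtain ⟨p', q', rfl, hp', hq'⟩ := h'
  refine ⟨p + p', q + q', ?_, norm_add_le_of_le hp hp', norm_add_le_of_le hq hq'⟩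
  rw [map_add, map_add]
  abel

theorem IsSmall.neg {t : ℝ} {r : L1AddLinf μ} (h : IsSmall t r) : IsSmall t (-r) := by
  obtain ⟨p, q, rfl, hp, hq⟩ := h
  refine ⟨-p, -q, ?_, by rwa [norm_neg], by rwa [norm_neg]⟩
  rw [map_neg, map_neg]
  abel

theorem isSmall_inclTop {t : ℝ} {q : Lp ℂ ∞ μ} (hq : ‖q‖ ≤ t) : IsSmall t (inclTop μ q) :=
  ⟨0, q, by simp, by simpa using (norm_nonneg q).trans hq, hq⟩

theorem inclTop_boundedL1ToLinf (v : boundedL1 μ) :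
    inclTop μ (boundedL1ToLinf μ v) = inclOne μ v.1 := rfl

variable {T : Lp ℂ 1 μ →ₗ[ℂ] Lp ℂ 1 μ} {S : L1AddLinf μ →ₗ[ℂ] L1AddLinf μ}

theorem IsContractiveExtension.isSmall_map (hS : IsContractiveExtension T S) {t : ℝ}
    {r : L1AddLinf μ} (h : IsSmall t r) : IsSmall t (S r) := by
  obtain ⟨p, q, rfl, hp, hq⟩ := h
  obtain ⟨k, hk, hk'⟩ := hS.map_inclTop q
  exact ⟨T p, k, by rw [map_add, hS.map_inclOne, hk],
    (hS.isDunfordSchwartz.norm_le p).trans hp, hk'.trans hq⟩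

theorem IsContractiveExtension.pow_inclOne (hS : IsContractiveExtension T S) (k : ℕ)
    (f : Lp ℂ 1 μ) : (S ^ k) (inclOne μ f) = inclOne μ ((T ^ k) f) := by
  induction k with
  | zero => rfl
  | succ k ih =>
    rw [pow_succ', pow_succ', Module.End.mul_apply, Module.End.mul_apply, ih, hS.map_inclOne]

theorem IsContractiveExtension.pow_inclTop (hS : IsContractiveExtension T S) (k : ℕ)
    (h : Lp ℂ ∞ μ) : ∃ g, (S ^ k) (inclTop μ h) = inclTop μ g ∧ ‖g‖ ≤ ‖h‖ := by
  induction k with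
  | zero => exact ⟨h, rfl, le_rfl⟩
  | succ k ih =>
    obtain ⟨g, hg, hg'⟩ := ih
    obtain ⟨g', h1, h2⟩ := hS.map_inclTop g
    exact ⟨g', by rw [pow_succ', Module.End.mul_apply, hg, h1], h2.trans hg'⟩

theorem weightedAverage_add (S : L1AddLinf μ →ₗ[ℂ] L1AddLinf μ) (β : ℕ → ℂ) (n : ℕ)
    (f g : L1AddLinf μ) :
    weightedAverage S β n (f + g) = weightedAverage S β n f + weightedAverage S β n g := by
  simp [weightedAverage, Finset.sum_add_distrib]

theorem weightedAverage_sub (S : L1AddLinf μ →ₗ[ℂ] L1AddLinf μ) (β : ℕ → ℂ) (n : ℕ)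
    (f g : L1AddLinf μ) :
    weightedAverage S β n (f - g) = weightedAverage S β n f - weightedAverage S β n g := by
  have h : weightedAverage S β n (f - g) + weightedAverage S β n g = weightedAverage S β n f := by
    rw [← weightedAverage_add, sub_add_cancel]
  exact eq_sub_of_add_eq h

theorem weightedAverage_sub_weight (S : L1AddLinf μ →ₗ[ℂ] L1AddLinf μ) (β γ : ℕ → ℂ) (n : ℕ)
    (f : L1AddLinf μ) : weightedAverage S (fun k => β k - γ k) n f
      = weightedAverage S β n f - weightedAverage S γ n f := by
  have h : weightedAverage S (fun k => β k - γ k) n f + weightedAverage S γ n f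
      = weightedAverage S β n f := by
    simp only [weightedAverage, ← smul_add, ← Finset.sum_add_distrib, ← add_smul, sub_add_cancel]
  exact eq_sub_of_add_eq h

theorem IsContractiveExtension.weightedAverage_inclOne (hS : IsContractiveExtension T S)
    (β : ℕ → ℂ) (n : ℕ) (f : Lp ℂ 1 μ) : weightedAverage S β n (inclOne μ f)
      = inclOne μ ((1 / n : ℂ) • ∑ k ∈ Finset.range n, β k • (T ^ k) f) := by
  simp [weightedAverage, hS.pow_inclOne, map_sum, map_smul]

theorem IsContractiveExtension.weightedAverage_inclTop (hS : IsContractiveExtension T S)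
    (β : ℕ → ℂ) (n : ℕ) (h : Lp ℂ ∞ μ) : ∃ g, weightedAverage S β n (inclTop μ h) = inclTop μ g ∧
      ‖g‖ ≤ (1 / n : ℝ) * (∑ k ∈ Finset.range n, ‖β k‖) * ‖h‖ := by
  choose g hg hg' using fun k => hS.pow_inclTop k h
  refine ⟨(1 / n : ℂ) • ∑ k ∈ Finset.range n, β k • g k, ?_, ?_⟩
  · simp [weightedAverage, hg, map_sum, map_smul]
  · rw [norm_smul, mul_assoc, Finset.sum_mul]
    have : ‖(1 / n : ℂ)‖ = 1 / n := by simp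
    rw [this]
    gcongr
    refine norm_sum_le_of_le _ fun k _ => ?_
    rw [norm_smul]
    gcongr
    exact hg' k

theorem average_norm_le {β : ℕ → ℂ} {C : ℝ} (hβ : ∀ k, ‖β k‖ ≤ C) (n : ℕ) :
    (1 / n : ℝ) * (∑ k ∈ Finset.range n, ‖β k‖) ≤ C := by
  have hC : 0 ≤ C := (norm_nonneg _).trans (hβ 0)
  have h1 : ∑ k ∈ Finset.range n, ‖β k‖ ≤ n * C :=
    (Finset.sum_le_sum fun k _ => hβ k).trans_eq (by simp)
  rcases Nat.eq_zero_or_pos n with rfl | hn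
  · simpa using hC
  · have hn' : (0 : ℝ) < n := by exact_mod_cast hn
    rw [one_div, inv_mul_le_iff₀ hn']
    exact h1

/-- The maximal inequality for small elements of `L¹ + L^∞`. -/
theorem IsContractiveExtension.maximal_isSmall (hS : IsContractiveExtension T S) {ε : ℝ}
    (hε : 0 < ε) {r : L1AddLinf μ} (hr : IsSmall (ε ^ 2) r) :
    ∃ G : Set Ω, MeasurableSet G ∧ μ Gᶜ ≤ ENNReal.ofReal ε ∧
      ∀ (β : ℕ → ℂ) (C : ℝ), (∀ k, ‖β k‖ ≤ C) → ∀ n : ℕ, ∀ᵐ x ∂μ, x ∈ G →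
        ‖(weightedAverage S β n r : Ω →ₘ[μ] ℂ) x‖ ≤ C * (ε + ε ^ 2) := by
  obtain ⟨p, q, rfl, hp, hq⟩ := hr
  obtain ⟨G, hGm, hG, hmax⟩ := hS.isDunfordSchwartz.maximal_inequality p hε
  refine ⟨G, hGm, ?_, fun β C hβ n => ?_⟩
  · have h1 : ENNReal.ofReal ε * μ Gᶜ ≤ ENNReal.ofReal ε * ENNReal.ofReal ε := by
      refine hG.trans ?_
      rw [← ENNReal.ofReal_mul hε.le, ← sq]
      exact ENNReal.ofReal_le_ofReal hp
    exact (ENNReal.mul_le_mul_iff_right (by simpa using hε) ENNReal.ofReal_ne_top).1 h1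
  · have hC : 0 ≤ C := (norm_nonneg _).trans (hβ 0)
    obtain ⟨g, hg, hg'⟩ := hS.weightedAverage_inclTop β n q
    have hg2 : ‖g‖ ≤ C * ε ^ 2 := hg'.trans (by
      have := average_norm_le hβ n
      gcongr)
    rw [weightedAverage_add, hg, hS.weightedAverage_inclOne]
    set P : Lp ℂ 1 μ := ∑ k ∈ Finset.range n, β k • (T ^ k) p
    filter_upwards [AEEqFun.coeFn_add ((1 / n : ℂ) • P : Lp ℂ 1 μ).1 g.1, ae_norm_le_norm g,
      Lp.coeFn_smul (1 / n : ℂ) P, hmax β C hβ n] with x h1 h2 h3 h4 hx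
    have h4 := h4 hx
    change ‖((((1 / n : ℂ) • P : Lp ℂ 1 μ).1 + g.1 : Ω →ₘ[μ] ℂ) : Ω → ℂ) x‖ ≤ _
    rw [h1, Pi.add_apply, mul_add]
    refine norm_add_le_of_le ?_ (h2.trans hg2)
    rw [h3, Pi.smul_apply, norm_smul]
    rcases Nat.eq_zero_or_pos n with rfl | hn
    · simp; positivity
    · have hn' : (0 : ℝ) < n := by exact_mod_cast hn
      have : ‖(1 / n : ℂ)‖ = (n : ℝ)⁻¹ := by simp
      rw [this, inv_mul_le_iff₀ hn']
      exact h4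

/-- The decomposition of a small function of `L²`. -/
theorem exists_isSmall_of_L2 {r : Lp ℂ 2 μ} {t : ℝ} (ht : 0 < t) (hr : ‖r‖ ≤ t) :
    ∃ e : L1AddLinf μ, (e : Ω →ₘ[μ] ℂ) = r ∧ IsSmall t e := by
  have hrm : Measurable r := (Lp.stronglyMeasurable r).measurable
  -- The cut is at height $t$: where $|r|>t$ one has $|r|\le t^{-1}|r|^2$, whose integral is at most
  -- $t$.
  let s : Set Ω := {x | t < ‖r x‖}
  have hs : MeasurableSet s := measurableSet_lt measurable_const hrm.norm
  have hsq : Integrable (fun x => ‖r x‖ ^ 2) μ :=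
    (memLp_two_iff_integrable_sq_norm (Lp.memLp r).1).1 (Lp.memLp r)
  have hrn : ∫ x, ‖r x‖ ^ 2 ∂μ = ‖r‖ ^ 2 := by
    have h1 : ((‖r‖ ^ 2 : ℝ) : ℂ) = ((∫ x, ‖r x‖ ^ 2 ∂μ : ℝ) : ℂ) := by
      rw [Complex.ofReal_pow, ← Complex.coe_algebraMap, ← inner_self_eq_norm_sq_to_K (𝕜 := ℂ),
        L2.inner_def, Complex.coe_algebraMap, ← integral_complex_ofReal]
      refine integral_congr_ae (.of_forall fun x => ?_)
      exact inner_self_eq_norm_sq_to_K (𝕜 := ℂ) (r x) |>.trans (by simp)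
    exact (Complex.ofReal_inj.1 h1).symm
  have hb : ∀ x, ‖s.indicator r x‖ ≤ t⁻¹ * ‖r x‖ ^ 2 := fun x => by
    by_cases hx : x ∈ s
    · rw [Set.indicator_of_mem hx, inv_mul_eq_div, le_div_iff₀ ht, sq]
      have : t < ‖r x‖ := hx
      gcongr
    · rw [Set.indicator_of_notMem hx, norm_zero]; positivity
  have hp : MemLp (s.indicator r) 1 μ := memLp_one_iff_integrable.2
    ((hsq.const_mul t⁻¹).mono' (hrm.indicator hs).aestronglyMeasurable (.of_forall hb))
  have hqb : ∀ x, ‖sᶜ.indicator r x‖ ≤ t := fun x => by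
    by_cases hx : x ∈ s
    · rw [Set.indicator_of_notMem (by simpa using hx), norm_zero]; exact ht.le
    · rw [Set.indicator_of_mem (by simpa using hx)]; exact not_lt.1 hx
  have hq : MemLp (sᶜ.indicator r) ∞ μ :=
    memLp_top_of_bound (hrm.indicator hs.compl).aestronglyMeasurable t (.of_forall hqb)
  refine ⟨inclOne μ hp.toLp + inclTop μ hq.toLp, ?_, hp.toLp, hq.toLp, rfl, ?_, ?_⟩
  · change (hp.toLp : Lp ℂ 1 μ).1 + (hq.toLp : Lp ℂ ∞ μ).1 = r.1
    refine AEEqFun.ext ?_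
    filter_upwards [AEEqFun.coeFn_add (hp.toLp : Lp ℂ 1 μ).1 (hq.toLp : Lp ℂ ∞ μ).1,
      hp.coeFn_toLp, hq.coeFn_toLp] with x h1 h2 h3
    rw [h1, Pi.add_apply, h2, h3]
    exact congrFun (Set.indicator_self_add_compl s r) x
  · rw [L1.norm_eq_integral_norm]
    calc ∫ x, ‖(hp.toLp : Lp ℂ 1 μ) x‖ ∂μ ≤ ∫ x, t⁻¹ * ‖r x‖ ^ 2 ∂μ := by
          refine integral_mono_ae (L1.integrable_coeFn _).norm (hsq.const_mul _) ?_
          filter_upwards [hp.coeFn_toLp] with x hx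
          rw [hx]
          exact hb x
      _ = t⁻¹ * ‖r‖ ^ 2 := by rw [integral_const_mul, hrn]
      _ ≤ t := by
          rw [inv_mul_le_iff₀ ht, ← sq]
          gcongr
  · refine norm_le_of_ae_norm_le ht.le ?_
    filter_upwards [hq.coeFn_toLp] with x hx
    rw [hx]
    exact hqb x

/-- Functions of `R_μ` are approximated by bounded integrable functions. -/
theorem exists_isSmall_sub_of_mem_Rmu {f : L1AddLinf μ} (hf : f ∈ Rmu μ) {t : ℝ} (ht : 0 < t) :
    ∃ v : boundedL1 μ, IsSmall t (f - inclOne μ v.1) := by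
  obtain ⟨a, ha, b, hb, hab⟩ := Submodule.mem_sup.1 f.2
  have hfm : Measurable f.1 := f.1.measurable
  let s : Set Ω := {x | t < ‖f.1 x‖}
  have hs : MeasurableSet s := measurableSet_lt measurable_const hfm.norm
  -- Membership in $\mathcal R_\mu$ enters here: on a set of finite measure the $L^\infty$ component
  -- of $f$ is integrable too.
  have hμs : Fact (μ s < ∞) := ⟨hf t ht⟩
  have hp : MemLp (s.indicator f.1) 1 μ := by
    rw [memLp_indicator_iff_restrict hs]
    have h1 : MemLp a 1 (μ.restrict s) := (Lp.mem_Lp_iff_memLp.1 ha).restrict s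
    have h2 : MemLp b 1 (μ.restrict s) :=
      ((Lp.mem_Lp_iff_memLp.1 hb).restrict s).mono_exponent le_top
    refine (h1.add h2).ae_eq (ae_restrict_of_ae ?_)
    rw [← hab]
    exact (AEEqFun.coeFn_add a b).symm
  have hqb : ∀ x, ‖sᶜ.indicator f.1 x‖ ≤ t := fun x => by
    by_cases hx : x ∈ s
    · rw [Set.indicator_of_notMem (by simpa using hx), norm_zero]; exact ht.le
    · rw [Set.indicator_of_mem (by simpa using hx)]; exact not_lt.1 hx
  have hq : MemLp (sᶜ.indicator f.1) ∞ μ :=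
    memLp_top_of_bound (hfm.indicator hs.compl).aestronglyMeasurable t (.of_forall hqb)
  obtain ⟨v, hv⟩ := (denseRange_boundedL1 μ).exists_dist_lt hp.toLp ht
  have hdec : f = inclOne μ hp.toLp + inclTop μ hq.toLp := by
    refine Subtype.ext ?_
    change f.1 = (hp.toLp : Lp ℂ 1 μ).1 + (hq.toLp : Lp ℂ ∞ μ).1
    refine AEEqFun.ext ?_
    filter_upwards [AEEqFun.coeFn_add (hp.toLp : Lp ℂ 1 μ).1 (hq.toLp : Lp ℂ ∞ μ).1,
      hp.coeFn_toLp, hq.coeFn_toLp] with x h1 h2 h3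
    rw [h1, Pi.add_apply, h2, h3]
    exact (congrFun (Set.indicator_self_add_compl s f.1) x).symm
  refine ⟨v, hp.toLp - v.1, hq.toLp, ?_, ?_, ?_⟩
  · rw [map_sub, sub_add_eq_add_sub, ← hdec]
  · rw [← dist_eq_norm]
    exact hv.le
  · refine norm_le_of_ae_norm_le ht.le ?_
    filter_upwards [hq.coeFn_toLp] with x hx
    rw [hx]
    exact hqb x

/-- The maximal inequality with $n=1$ and weight $1$ is an estimate of $r$ itself:
$|r|\le\varepsilon+\varepsilon^2$ off a set of measure at most $\varepsilon$, for every
$\varepsilon$. -/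
theorem IsContractiveExtension.eq_zero_of_isSmall (hS : IsContractiveExtension T S)
    {r : L1AddLinf μ} (hr : ∀ t : ℝ, 0 < t → IsSmall t r) : r = 0 := by
  refine Subtype.ext (AEEqFun.ext (.trans ?_ AEEqFun.coeFn_zero.symm))
  have key : ∀ k : ℕ, μ {x | 2 * (1 / 2 : ℝ) ^ k < ‖r.1 x‖} = 0 := by
    intro k
    refine le_antisymm (ge_of_tendsto (x := 𝓝[>] (0 : ℝ)) (f := ENNReal.ofReal) ?_ ?_) zero_le
    · have : Tendsto ENNReal.ofReal (𝓝 0) (𝓝 (ENNReal.ofReal 0)) :=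
        ENNReal.continuous_ofReal.tendsto 0
      rw [ENNReal.ofReal_zero] at this
      exact this.mono_left nhdsWithin_le_nhds
    · have hk : (0 : ℝ) < (1 / 2) ^ k := by positivity
      have hk1 : (1 / 2 : ℝ) ^ k ≤ 1 := pow_le_one₀ (by norm_num) (by norm_num)
      filter_upwards [self_mem_nhdsWithin, Ioo_mem_nhdsGT hk] with ε hε hε'
      obtain ⟨G, hGm, hG, H⟩ := hS.maximal_isSmall (Set.mem_Ioi.1 hε) (hr _ (sq_pos_of_pos hε))
      refine le_trans (measure_mono_ae ?_) hG
      filter_upwards [H (fun _ => 1) 1 (by simp) 1] with x hx hx' hxG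
      have h1 := hx hxG
      simp only [weightedAverage, Finset.range_one, Finset.sum_singleton, pow_zero,
        Module.End.one_apply, one_smul, Nat.cast_one, div_one] at h1
      have h2 : 2 * (1 / 2 : ℝ) ^ k < ‖r.1 x‖ := hx'
      have h3 := hε'.2
      have h4 := hε'.1
      nlinarith
  have key' : ∀ᵐ x ∂μ, ∀ k : ℕ, ‖r.1 x‖ ≤ 2 * (1 / 2 : ℝ) ^ k := ae_all_iff.2 fun k => by
    filter_upwards [measure_eq_zero_iff_ae_notMem.1 (key k)] with x hx
    exact not_lt.1 hx
  filter_upwards [key'] with x hx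
  have hlim0 : Tendsto (fun j : ℕ => 2 * (1 / 2 : ℝ) ^ j) atTop (𝓝 0) := by
    simpa using (tendsto_pow_atTop_nhds_zero_of_lt_one (r := (1 / 2 : ℝ)) (by norm_num)
      (by norm_num)).const_mul 2
  exact norm_le_zero_iff.1 (ge_of_tendsto' hlim0 hx)

end Small

section Convergence

variable {Ω : Type*} [MeasurableSpace Ω] {μ : Measure Ω} {T : Lp ℂ 1 μ →ₗ[ℂ] Lp ℂ 1 μ}
  {S : L1AddLinf μ →ₗ[ℂ] L1AddLinf μ}

/-! ### Unweighted averages -/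

theorem IsExtension.isContractiveExtension (hT : IsDunfordSchwartz T) (hS : IsExtension T S) :
    IsContractiveExtension T S := by
  obtain ⟨R, h1, h2, -⟩ := hS.exists_restrict
  exact ⟨hT, hS.map_inclOne, fun h => ⟨R h, h1 h, h2 h⟩⟩

/-- Rotation preserves all the norm bounds, so results on unweighted averages of $\lambda S$ become
results on $S$ with the weight $\lambda^k$. -/
theorem IsContractiveExtension.unimodular_smul (hS : IsContractiveExtension T S) (l : Circle) :
    IsContractiveExtension ((l : ℂ) • T) ((l : ℂ) • S) where
  isDunfordSchwartz :=
    { norm_le := fun f => by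
        rw [LinearMap.smul_apply, norm_smul, Circle.norm_coe, one_mul]
        exact hS.isDunfordSchwartz.norm_le f
      eLpNorm_top_le := fun f hf => by
        rw [LinearMap.smul_apply, eLpNorm_congr_ae (Lp.coeFn_smul _ _), eLpNorm_const_smul,
          ← ofReal_norm, Circle.norm_coe, ENNReal.ofReal_one, one_mul]
        exact hS.isDunfordSchwartz.eLpNorm_top_le f hf }
  map_inclOne f := by
    rw [LinearMap.smul_apply, hS.map_inclOne, LinearMap.smul_apply, map_smul]
  map_inclTop h := by
    obtain ⟨k, hk, hk'⟩ := hS.map_inclTop h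
    refine ⟨(l : ℂ) • k, by rw [LinearMap.smul_apply, hk, map_smul], ?_⟩
    rwa [norm_smul, Circle.norm_coe, one_mul]

/-- The coboundaries of bounded functions. -/
noncomputable def boundedCoboundary (S : L1AddLinf μ →ₗ[ℂ] L1AddLinf μ) :
    Submodule ℂ (L1AddLinf μ) :=
  (LinearMap.range (inclTop μ)).map (LinearMap.id - S)

theorem IsContractiveExtension.sub_pow_mem_boundedCoboundary (hS : IsContractiveExtension T S)
    (h : Lp ℂ ∞ μ) (k : ℕ) : inclTop μ h - (S ^ k) (inclTop μ h) ∈ boundedCoboundary S := by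
  induction k with
  | zero =>
    rw [pow_zero, Module.End.one_apply, sub_self]
    exact Submodule.zero_mem _
  | succ k ih =>
    obtain ⟨g, hg, -⟩ := hS.pow_inclTop k h
    have h1 : inclTop μ h - (S ^ (k + 1)) (inclTop μ h)
        = (inclTop μ h - (S ^ k) (inclTop μ h)) + (inclTop μ g - S (inclTop μ g)) := by
      rw [pow_succ', Module.End.mul_apply, hg]
      abel
    rw [h1]
    exact Submodule.add_mem _ ih ⟨inclTop μ g, ⟨g, rfl⟩, rfl⟩

/-- The average of $w-Sw$ telescopes to $(w-S^nw)/n$, of norm at most $2\|w\|_\infty/n$. -/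
theorem IsContractiveExtension.average_boundedCoboundary (hS : IsContractiveExtension T S)
    {f : L1AddLinf μ} (hf : f ∈ boundedCoboundary S) : ∃ D : ℝ, ∀ n : ℕ, ∃ g,
      weightedAverage S (fun _ => 1) n f = inclTop μ g ∧ ‖g‖ ≤ D / n := by
  obtain ⟨_, ⟨w, rfl⟩, rfl⟩ := hf
  refine ⟨‖w‖ + ‖w‖, fun n => ?_⟩
  obtain ⟨w', hw, hw'⟩ := hS.pow_inclTop n w
  refine ⟨(1 / n : ℂ) • (w - w'), ?_, ?_⟩
  · have h1 : ∀ k, (1 : ℂ) • (S ^ k) ((LinearMap.id - S : L1AddLinf μ →ₗ[ℂ] L1AddLinf μ) (inclTop μ w))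
        = (S ^ k) (inclTop μ w) - (S ^ (k + 1)) (inclTop μ w) := fun k => by
      rw [one_smul, LinearMap.sub_apply, LinearMap.id_apply, map_sub, pow_succ,
        Module.End.mul_apply]
    rw [weightedAverage, Finset.sum_congr rfl fun k _ => h1 k,
      Finset.sum_range_sub' (fun k => (S ^ k) (inclTop μ w)) n, hw, map_smul, map_sub]
    rfl
  · have : ‖(1 / n : ℂ)‖ = (n : ℝ)⁻¹ := by simp
    rw [norm_smul, this, div_eq_inv_mul]
    gcongr
    exact norm_sub_le_of_le le_rfl hw'

theorem map_weightedAverage (S : L1AddLinf μ →ₗ[ℂ] L1AddLinf μ) (β : ℕ → ℂ) (n : ℕ)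
    (f : L1AddLinf μ) : S (weightedAverage S β n f) = weightedAverage S β n (S f) := by
  simp only [weightedAverage, map_smul, map_sum]
  congr 1
  refine Finset.sum_congr rfl fun k _ => ?_
  rw [← Module.End.mul_apply, ← pow_succ', pow_succ, Module.End.mul_apply]

theorem weightedAverage_fixed {u : L1AddLinf μ} (hu : S u = u) {n : ℕ} (hn : n ≠ 0) :
    weightedAverage S (fun _ => 1) n u = u := by
  have h1 : ∀ k, (S ^ k) u = u := fun k => by
    induction k with
    | zero => rfl
    | succ k ih => rw [pow_succ', Module.End.mul_apply, ih, hu]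
  have hn' : (n : ℂ) ≠ 0 := by exact_mod_cast hn
  simp only [weightedAverage, h1, one_smul, Finset.sum_const, Finset.card_range]
  rw [← Nat.cast_smul_eq_nsmul ℂ, smul_smul, one_div, inv_mul_cancel₀ hn', one_smul]

/-- The averages of a bounded integrable function approach a fixed function. -/
theorem IsContractiveExtension.exists_fixed [SigmaFinite μ] (hS : IsContractiveExtension T S)
    (v : boundedL1 μ) : ∃ u : L1AddLinf μ, S u = u ∧ ∀ t : ℝ, 0 < t → ∀ᶠ n in atTop,
      IsSmall t (weightedAverage S (fun _ => 1) n (inclOne μ v.1) - u) := by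
  have hT := hS.isDunfordSchwartz
  obtain ⟨u₂, hu₂⟩ := hT.exists_tendsto_L2 v
  -- The decomposition is used only to see the $L^2$ limit as an element of $L^1+L^\infty$; any
  -- positive bound for its norm would do.
  obtain ⟨u, hu, -⟩ := exists_isSmall_of_L2 (r := u₂) (t := ‖u₂‖ + 1) (by positivity) (by simp)
  have hsmall : ∀ t : ℝ, 0 < t → ∀ᶠ n in atTop,
      IsSmall t (weightedAverage S (fun _ => 1) n (inclOne μ v.1) - u) := by
    intro t ht
    filter_upwards [Metric.tendsto_nhds.1 hu₂ t ht] with n hn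
    rw [dist_eq_norm] at hn
    obtain ⟨e, he, he'⟩ := exists_isSmall_of_L2 ht hn.le
    convert he'
    refine Subtype.ext (.trans ?_ he.symm)
    have h1 : ((n : ℂ)⁻¹ • ∑ k ∈ Finset.range n, (hT.restrict ^ k) v : boundedL1 μ).1
        = (1 / n : ℂ) • ∑ k ∈ Finset.range n, (1 : ℂ) • (T ^ k) v.1 := by
      simp only [Submodule.coe_smul, Submodule.coe_sum, hT.coe_restrict_pow, one_smul, one_div]
    rw [hS.weightedAverage_inclOne, ← h1]
    change _ - u.1 = _ - u₂.1
    rw [hu]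
    rfl
  refine ⟨u, sub_eq_zero.1 (hS.eq_zero_of_isSmall fun t ht => ?_), hsmall⟩
  obtain ⟨D, hD⟩ := hS.average_boundedCoboundary
    (hS.sub_pow_mem_boundedCoboundary (boundedL1ToLinf μ v) 1)
  rw [inclTop_boundedL1ToLinf, pow_one] at hD
  obtain ⟨n, hn1, hn2⟩ := ((hsmall (t / 3) (by positivity)).and
    ((tendsto_const_div_atTop_nhds_zero_nat D).eventually
      (gt_mem_nhds (show 0 < t / 3 by positivity)))).exists
  obtain ⟨g, hg, hg'⟩ := hD n
  rw [weightedAverage_sub, ← map_weightedAverage] at hg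
  have h2 := isSmall_inclTop (hg'.trans hn2.le)
  rw [← hg] at h2
  -- $Su-u=-S(A_nv-u)-(A_nv-SA_nv)+(A_nv-u)$. The middle difference is $A_n(v-Sv)$, the average of a
  -- bounded coboundary.
  have h3 := ((hS.isSmall_map hn1).neg.add h2.neg).add hn1
  rw [map_sub] at h3
  convert h3 using 1
  · ring
  · abel

theorem exists_pos_mul_add_sq_le {C ε : ℝ} (hC : 0 ≤ C) (hε : 0 < ε) :
    ∃ η : ℝ, 0 < η ∧ η ≤ ε ∧ C * (η + η ^ 2) ≤ ε := by
  have hpos : 0 < 2 * C + 1 := by positivity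
  -- Since $\eta\le1$ gives $\eta^2\le\eta$, it is enough that $2C\eta\le\varepsilon$.
  refine ⟨min 1 (ε / (2 * C + 1)), by positivity, ?_, ?_⟩
  · exact (min_le_right _ _).trans (div_le_self hε.le (by linarith))
  · set η := min 1 (ε / (2 * C + 1))
    have h1 : η ≤ 1 := min_le_left _ _
    have h2 : η ≤ ε / (2 * C + 1) := min_le_right _ _
    have h0 : 0 < η := by positivity
    rw [le_div_iff₀ hpos] at h2
    have h3 : η ^ 2 ≤ η := by nlinarith
    nlinarith

theorem IsContractiveExtension.auCauchy_average [SigmaFinite μ] (hS : IsContractiveExtension T S)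
    (v : boundedL1 μ) : AUCauchy fun n =>
      (weightedAverage S (fun _ => 1) n (inclOne μ v.1) : Ω →ₘ[μ] ℂ) := by
  obtain ⟨u, hu, hsmall⟩ := hS.exists_fixed v
  refine AUCauchy.of_approx fun ε hε => ⟨fun _ => u.1, auCauchy_const _, ?_⟩
  obtain ⟨η, hη, hηε, hη2⟩ := exists_pos_mul_add_sq_le zero_le_one (half_pos hε)
  obtain ⟨m, hm, hm0⟩ := ((hsmall (η ^ 2) (by positivity)).and (eventually_ne_atTop 0)).exists
  set w := weightedAverage S (fun _ => 1) m (inclOne μ v.1) with hw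
  -- $v-A_mv$ is the mean of the differences $v-S^kv$ with $k<m$, each a bounded coboundary.
  have hcob : inclOne μ v.1 - w ∈ boundedCoboundary S := by
    have hm' : (m : ℂ) ≠ 0 := by exact_mod_cast hm0
    have h1 : inclOne μ v.1 - w = (1 / m : ℂ) • ∑ k ∈ Finset.range m,
        (inclOne μ v.1 - (S ^ k) (inclOne μ v.1)) := by
      simp only [hw, weightedAverage, one_smul]
      rw [Finset.sum_sub_distrib, smul_sub, Finset.sum_const, Finset.card_range,
        ← Nat.cast_smul_eq_nsmul ℂ, smul_smul, one_div, inv_mul_cancel₀ hm', one_smul]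
    rw [h1]
    exact Submodule.smul_mem _ _ (Submodule.sum_mem _ fun k _ =>
      hS.sub_pow_mem_boundedCoboundary (boundedL1ToLinf μ v) k)
  obtain ⟨D, hD⟩ := hS.average_boundedCoboundary hcob
  obtain ⟨G, hGm, hG, hmax⟩ := hS.maximal_isSmall hη hm
  refine ⟨G, hGm, hG.trans (ENNReal.ofReal_le_ofReal (by linarith)), ?_⟩
  obtain ⟨N, hN⟩ := eventually_atTop.1 (((tendsto_const_div_atTop_nhds_zero_nat D).eventually
      (gt_mem_nhds (half_pos hε))).and (eventually_ne_atTop 0))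
  refine ⟨N, fun n hn => ?_⟩
  obtain ⟨hn1, hn0⟩ := hN n hn
  obtain ⟨g, hg, hg'⟩ := hD n
  -- The index $m$ and the set `G` are fixed before $n$: the first term vanishes uniformly as
  -- $n\to\infty$, the second is small on `G` for all $n$, and the last is the limit. Fixedness of
  -- $u$ needs $n\ne0$, as the average with $n=0$ is $0$.
  have hsplit : weightedAverage S (fun _ => 1) n (inclOne μ v.1)
      = inclTop μ g + weightedAverage S (fun _ => 1) n (w - u) + u := by
    rw [← hg, weightedAverage_sub, weightedAverage_sub, weightedAverage_fixed hu hn0]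
    abel
  rw [hsplit]
  set z := weightedAverage S (fun _ => 1) n (w - u) with hz
  filter_upwards [AEEqFun.coeFn_add (g.1 + z.1) u.1, AEEqFun.coeFn_add g.1 z.1, ae_norm_le_norm g,
    hmax (fun _ => 1) 1 (by simp) n] with x h1 h2 h3 h4 hx
  change ‖((g.1 + z.1 + u.1 : Ω →ₘ[μ] ℂ) : Ω → ℂ) x - u.1 x‖ ≤ ε
  rw [h1, Pi.add_apply, h2, Pi.add_apply, add_sub_cancel_right]
  refine (norm_add_le_of_le (h3.trans (hg'.trans hn1.le)) ((h4 hx).trans hη2)).trans_eq ?_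
  ring

/-! ### Besicovitch weights -/

theorem IsContractiveExtension.auCauchy_trigPolynomial [SigmaFinite μ]
    (hS : IsContractiveExtension T S) {P : ℤ → ℂ} (hP : IsTrigPolynomial P) (v : boundedL1 μ) :
    AUCauchy fun n => (weightedAverage S (fun k => P k) n (inclOne μ v.1) : Ω →ₘ[μ] ℂ) := by
  obtain ⟨s, z, l, hP⟩ := hP
  have h1 : ∀ n, (weightedAverage S (fun k => P k) n (inclOne μ v.1) : Ω →ₘ[μ] ℂ)
      = ∑ j : Fin s, z j •
        (weightedAverage ((l j : ℂ) • S) (fun _ => 1) n (inclOne μ v.1) : Ω →ₘ[μ] ℂ) := fun n => by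
    have : weightedAverage S (fun k => P k) n (inclOne μ v.1)
        = ∑ j : Fin s, z j • weightedAverage ((l j : ℂ) • S) (fun _ => 1) n (inclOne μ v.1) := by
      simp only [weightedAverage, hP, smul_pow, LinearMap.smul_apply, one_smul, zpow_natCast,
        Finset.sum_smul, mul_smul]
      rw [Finset.sum_comm, Finset.smul_sum]
      refine Finset.sum_congr rfl fun j _ => ?_
      rw [← Finset.smul_sum, smul_comm]
    rw [this, Submodule.coe_sum]
    rfl
  simp only [h1]
  exact AUCauchy.sum _ fun j => ((hS.unimodular_smul (l j)).auCauchy_average v).smul (z j)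

/-- For bounded $v$, replacing $\beta$ by $P$ changes the average by at most
$\|v\|_\infty\,\frac1n\sum_{k<n}|\beta_k-P(k)|$ in $L^\infty$. No exceptional set is needed. -/
theorem IsContractiveExtension.auCauchy_besicovitch_bounded [SigmaFinite μ]
    (hS : IsContractiveExtension T S) {β : ℕ → ℂ} (hβ : IsBoundedBesicovitch β)
    (v : boundedL1 μ) :
    AUCauchy fun n => (weightedAverage S β n (inclOne μ v.1) : Ω →ₘ[μ] ℂ) := by
  refine AUCauchy.of_approx fun ε hε => ?_
  set h := boundedL1ToLinf μ v
  have hpos : 0 < ‖h‖ + 1 := by positivity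
  obtain ⟨P, hP, hlim⟩ := hβ.2 (ε / (‖h‖ + 1)) (by positivity)
  refine ⟨_, hS.auCauchy_trigPolynomial hP v, Set.univ, .univ, by simp, ?_⟩
  obtain ⟨N, hN⟩ := eventually_atTop.1 (eventually_lt_of_limsup_lt hlim)
  refine ⟨N, fun n hn => ?_⟩
  have hn' := EReal.coe_lt_coe_iff.1 (hN n hn)
  obtain ⟨g, hg, hg'⟩ := hS.weightedAverage_inclTop (fun k => β k - P k) n h
  rw [weightedAverage_sub_weight, inclTop_boundedL1ToLinf] at hg
  have hgε : ‖g‖ ≤ ε := hg'.trans (by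
    calc _ ≤ ε / (‖h‖ + 1) * (‖h‖ + 1) := by
          gcongr
          linarith
      _ = ε := div_mul_cancel₀ _ hpos.ne')
  have hg1 := congrArg Subtype.val hg
  change _ - _ = g.1 at hg1
  filter_upwards [ae_norm_le_norm g, AEEqFun.coeFn_sub
    (weightedAverage S β n (inclOne μ v.1)).1
    (weightedAverage S (fun k => P k) n (inclOne μ v.1)).1] with x h1 h2 _
  rw [← Pi.sub_apply, ← h2]
  exact (congrArg (fun F : Ω →ₘ[μ] ℂ => ‖F x‖) hg1).trans_le (h1.trans hgε)

/-- Banach's principle: $f-v$ is small, and the maximal inequality controls its weighted averages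
for all $n$ off one small set. -/
theorem IsContractiveExtension.auCauchy_besicovitch [SigmaFinite μ]
    (hS : IsContractiveExtension T S) {β : ℕ → ℂ} (hβ : IsBoundedBesicovitch β)
    {f : L1AddLinf μ} (hf : f ∈ Rmu μ) :
    AUCauchy fun n => (weightedAverage S β n f : Ω →ₘ[μ] ℂ) := by
  obtain ⟨C, hC⟩ := hβ.1
  have hC0 : 0 ≤ C := (norm_nonneg _).trans (hC 0)
  refine AUCauchy.of_approx fun ε hε => ?_
  obtain ⟨η, hη, hηε, hη2⟩ := exists_pos_mul_add_sq_le hC0 hε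
  obtain ⟨v, hv⟩ := exists_isSmall_sub_of_mem_Rmu hf (sq_pos_of_pos hη)
  obtain ⟨G, hGm, hG, hmax⟩ := hS.maximal_isSmall hη hv
  refine ⟨_, hS.auCauchy_besicovitch_bounded hβ v, G, hGm,
    hG.trans (ENNReal.ofReal_le_ofReal hηε), 0, fun n _ => ?_⟩
  have h0 := hmax β C hC n
  rw [weightedAverage_sub] at h0
  filter_upwards [h0, AEEqFun.coeFn_sub (weightedAverage S β n f).1
    (weightedAverage S β n (inclOne μ v.1)).1] with x h1 h2 hx
  rw [← Pi.sub_apply, ← h2]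
  exact (h1 hx).trans hη2

/-! ### The limit -/

theorem inclOne_mem_Rmu (f : Lp ℂ 1 μ) : inclOne μ f ∈ Rmu μ := fun _ hc =>
  (L1.integrable_coeFn f).measure_norm_gt_lt_top hc

theorem IsDunfordSchwartz.norm_pow_le (hT : IsDunfordSchwartz T) (k : ℕ) (f : Lp ℂ 1 μ) :
    ‖(T ^ k) f‖ ≤ ‖f‖ := by
  induction k with
  | zero => exact le_rfl
  | succ k ih =>
    rw [pow_succ', Module.End.mul_apply]
    exact (hT.norm_le _).trans ih

/-- Fatou's lemma: the averages have $L^1$ norms at most $C\|f\|_1$. -/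
theorem IsContractiveExtension.memLp_limit_inclOne (hS : IsContractiveExtension T S) {β : ℕ → ℂ}
    {C : ℝ} (hC : ∀ k, ‖β k‖ ≤ C) (f : Lp ℂ 1 μ) {g : Ω →ₘ[μ] ℂ}
    (hg : ∀ᵐ x ∂μ, Tendsto
      (fun n => (weightedAverage S β n (inclOne μ f) : Ω →ₘ[μ] ℂ) x) atTop (𝓝 (g x))) :
    MemLp g 1 μ := by
  refine ⟨g.aestronglyMeasurable, ?_⟩
  have h1 := Lp.eLpNorm_lim_le_liminf_eLpNorm (p := 1)
    (f := fun n => ((weightedAverage S β n (inclOne μ f) : Ω →ₘ[μ] ℂ) : Ω → ℂ))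
    (fun n => AEEqFun.aestronglyMeasurable _) g hg
  have h2 : ∀ n, eLpNorm (weightedAverage S β n (inclOne μ f) : Ω →ₘ[μ] ℂ) 1 μ
      ≤ ENNReal.ofReal (C * ‖f‖) := fun n => by
    rw [hS.weightedAverage_inclOne]
    set F : Lp ℂ 1 μ := (1 / n : ℂ) • ∑ k ∈ Finset.range n, β k • (T ^ k) f
    change eLpNorm F 1 μ ≤ _
    rw [← ENNReal.ofReal_toReal (Lp.eLpNorm_ne_top F), ← Lp.norm_def]
    refine ENNReal.ofReal_le_ofReal ?_
    have h3 : ‖∑ k ∈ Finset.range n, β k • (T ^ k) f‖ ≤ (∑ k ∈ Finset.range n, ‖β k‖) * ‖f‖ := by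
      rw [Finset.sum_mul]
      refine norm_sum_le_of_le _ fun k _ => ?_
      rw [norm_smul]
      gcongr
      exact hS.isDunfordSchwartz.norm_pow_le k f
    have h4 : ‖(1 / n : ℂ)‖ = 1 / n := by simp
    rw [norm_smul, h4]
    calc (1 / n : ℝ) * ‖∑ k ∈ Finset.range n, β k • (T ^ k) f‖
        ≤ (1 / n : ℝ) * ((∑ k ∈ Finset.range n, ‖β k‖) * ‖f‖) := by gcongr
      _ ≤ C * ‖f‖ := by
          rw [← mul_assoc]
          have := average_norm_le hC n
          gcongr
  refine (h1.trans ((liminf_le_liminf (.of_forall h2)).trans_eq (liminf_const _))).trans_lt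
    ENNReal.ofReal_lt_top

/-- The limit of the averages is approximated in `L^∞` by integrable functions. -/
theorem IsContractiveExtension.exists_memLp_near_limit [SigmaFinite μ]
    (hS : IsContractiveExtension T S) {β : ℕ → ℂ} (hβ : IsBoundedBesicovitch β)
    {f : L1AddLinf μ} (hf : f ∈ Rmu μ) {g : Ω →ₘ[μ] ℂ}
    (hg : ∀ᵐ x ∂μ, Tendsto (fun n => (weightedAverage S β n f : Ω →ₘ[μ] ℂ) x) atTop (𝓝 (g x)))
    {t : ℝ} (ht : 0 < t) : ∃ g₁ : Ω →ₘ[μ] ℂ, MemLp g₁ 1 μ ∧ ∀ᵐ x ∂μ, ‖g x - g₁ x‖ ≤ t := by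
  obtain ⟨C, hC⟩ := hβ.1
  have hC0 : 0 ≤ C := (norm_nonneg _).trans (hC 0)
  have hpos : 0 < C + 1 := by positivity
  -- Only the $L^\infty$ part `q` has to be small. The integrable part `p` joins `v`, and the
  -- averages of `q` stay within $C\cdot t/(C+1)\le t$.
  obtain ⟨v, p, q, hpq, -, hq⟩ := exists_isSmall_sub_of_mem_Rmu hf (div_pos ht hpos)
  have hfdec : f = inclOne μ (p + v.1) + inclTop μ q := by
    rw [map_add, add_right_comm, ← hpq, sub_add_cancel]
  obtain ⟨g₁, -, hg₁⟩ := (hS.auCauchy_besicovitch hβ (inclOne_mem_Rmu (p + v.1))).exists_limit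
  refine ⟨g₁, hS.memLp_limit_inclOne hC _ hg₁, ?_⟩
  choose w hw hw' using fun n => hS.weightedAverage_inclTop β n q
  have hwt : ∀ n, ‖w n‖ ≤ t := fun n => (hw' n).trans (by
    calc _ ≤ (C + 1) * (t / (C + 1)) := by
          have := average_norm_le hC n
          gcongr
          linarith
      _ = t := mul_div_cancel₀ _ hpos.ne')
  have hae : ∀ᵐ x ∂μ, ∀ n, (weightedAverage S β n f : Ω →ₘ[μ] ℂ) x
      = (weightedAverage S β n (inclOne μ (p + v.1)) : Ω →ₘ[μ] ℂ) x + w n x := by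
    refine ae_all_iff.2 fun n => ?_
    have h1 : weightedAverage S β n f
        = weightedAverage S β n (inclOne μ (p + v.1)) + inclTop μ (w n) := by
      rw [← hw, ← weightedAverage_add, ← hfdec]
    rw [h1]
    exact AEEqFun.coeFn_add (weightedAverage S β n (inclOne μ (p + v.1))).1 (w n).1
  filter_upwards [hg, hg₁, hae, ae_all_iff.2 fun n => ae_norm_le_norm (w n)] with x h1 h2 h3 h4
  refine le_of_tendsto' (h1.sub h2).norm fun n => ?_
  rw [h3, add_sub_cancel_left]
  exact (h4 n).trans (hwt n)

/-- With $t=c/2$, the set $\{|g|>c\}$ lies almost everywhere in $\{|g_1|>c/2\}$, which has finite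
measure as $g_1$ is integrable. Any single $t$ already gives $g\in L^1+L^\infty$. -/
theorem exists_mem_Rmu_of_near {g : Ω →ₘ[μ] ℂ} (H : ∀ t : ℝ, 0 < t → ∃ g₁ : Ω →ₘ[μ] ℂ,
    MemLp g₁ 1 μ ∧ ∀ᵐ x ∂μ, ‖g x - g₁ x‖ ≤ t) : ∃ e ∈ Rmu μ, (e : Ω →ₘ[μ] ℂ) = g := by
  have hmem : g ∈ L1AddLinf μ := by
    obtain ⟨g₁, h1, h2⟩ := H 1 one_pos
    rw [← add_sub_cancel g₁ g]
    refine Submodule.add_mem_sup (Lp.mem_Lp_iff_memLp.2 h1) (Lp.mem_Lp_iff_memLp.2 ?_)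
    refine memLp_top_of_bound (AEEqFun.aestronglyMeasurable _) 1 ?_
    filter_upwards [h2, AEEqFun.coeFn_sub g g₁] with x h3 h4
    rwa [h4]
  refine ⟨⟨g, hmem⟩, fun c hc => ?_, rfl⟩
  obtain ⟨g₁, h1, h2⟩ := H (c / 2) (half_pos hc)
  refine lt_of_le_of_lt (measure_mono_ae ?_)
    ((memLp_one_iff_integrable.1 h1).measure_norm_gt_lt_top (half_pos hc))
  filter_upwards [h2] with x hx hx'
  have h3 : c < ‖g x‖ := hx'
  have h4 := norm_sub_norm_le (g x) (g₁ x)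
  change c / 2 < ‖g₁ x‖
  linarith

end Convergence

end DunfordSchwartz

theorem theorem4p4 {Ω : Type*} [MeasurableSpace Ω] (μ : Measure Ω) [SigmaFinite μ]
    (T : Lp ℂ 1 μ →ₗ[ℂ] Lp ℂ 1 μ) (hT : DunfordSchwartz.IsDunfordSchwartz T)
    (β : ℕ → ℂ) (hβ : DunfordSchwartz.IsBoundedBesicovitch β)
    (f : DunfordSchwartz.L1AddLinf μ) (hf : f ∈ DunfordSchwartz.Rmu μ) :
    ∃ fhat ∈ DunfordSchwartz.Rmu μ,
      DunfordSchwartz.TendstoAU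
        (fun n => (DunfordSchwartz.weightedAverage hT.extension β n f : Ω →ₘ[μ] ℂ))
        (fhat : Ω →ₘ[μ] ℂ) := by
  have hS := hT.isExtension_extension.isContractiveExtension hT
  obtain ⟨g, hg, hlim⟩ := (hS.auCauchy_besicovitch hβ hf).exists_limit
  obtain ⟨e, he, rfl⟩ := DunfordSchwartz.exists_mem_Rmu_of_near fun t ht =>
    hS.exists_memLp_near_limit hβ hf hlim ht
  exact ⟨e, he, hg⟩
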